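/- **Setting.** Let $d\in\mathbb N$, $T>0$, and let $E:[0,T]\times\mathbb R^d\to\mathbb R$ satisfy: $E\in C^1([0,T]\times\mathbb R^d)$ and $\nabla_xE(t,\cdot)$ is locally Lipschitz, uniformly in $t\in[0,T]$; $|\partial_tE|\le C_1+C_2E$ for some $C_1,C_2>0$; $E(t,x)\ge C_3|x|^q-C_4$ for some $C_3,C_4>0$, $q>1$; and for all $(t,u)\in[0,T]\times\mathbb R^d$ the set $\{x:\nabla_xE(t,x)=u\}$ consists of isolated points. Let $f:\mathbb R^d\to\mathbb R^d$ be locally Lipschitz with $|f(u)|\le C_f(1+|u|)$. Put $\overline E(t,x,u)=E(t,x)-u\cdot x$, $\Gamma_T^p=L^p([0,T];\mathbb R^d)$ with $p\in[1,\infty)$, $\Lambda=C([0,T];\mathbb R^d)$. For $\varepsilon>0$ and $(x_0,u_0)\in\mathbb R^d\times\mathbb R^d$ let $Y_\varepsilon(x_0,u_0)=(x_\varepsilon(\cdot),u_\varepsilon(\cdot))\in\Gamma_T^p\times\Lambda$ be the solution on $[0,T]$ of $$\varepsilon\dot x=-\nabla_xE(t,x)+u,\qquad \dot u=f(u),\qquad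 (x(0),u(0))=(x_0,u_0).$$ Let $\eta_0$ be a compactly supported Borel probability measure on $\mathbb R^d\times\mathbb R^d$, let $\Pi_\varepsilon$ be the law of $(x_0,u_0,Y_\varepsilon(x_0,u_0))$ on $\mathbb R^d\times\mathbb R^d\times\Gamma^p_T\times\Lambda$ when $(x_0,u_0)\sim\eta_0$, let $\Pi$ be a probability measure that is the narrow limit of $\Pi_{\varepsilon_n}$ for some sequence $0<\varepsilon_n\to0$, and let $\Pi^*$ be its marginal on $\Gamma_T^p\times\Lambda$. A *dissipation measure* of $(x,u)\in\Gamma_T^p\times\Lambda$ is a positive bounded Radon measure $\nu$ on the open interval $(0,T)$ for which there are $0<\varepsilon_n\to0$ and solutions $(x_n,u_n)$ of the system for $\varepsilon=\varepsilon_n$, with convergent initial data, such that $(x_n,u_n)\to(x,u)$ in $\Gamma_T^p\times\Lambda$ and $$\Big(\tfrac{\varepsilon_n}{2}|\dot x_n|^2+\tfrac1{2\varepsilon_n}|\nabla_xE(\cdot,x_n)-u_n|^2\Big)\mathcal L^1\rightharpoonup\nu\quad\text{weakly* in }\mathcal M_b(0,T)=C_0(0,T)^*.$$ **Theorem (mean-field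 energy balance).** The support of $\Pi^*$ has full $\Pi^*$-measure. Every $(x,u)\in\operatorname{supp}\Pi^*$ has exactly one dissipation measure $\nu_{(\tilde x,u)}$, the function $\tau\mapsto\partial_tE(\tau,x(\tau))-f(u(\tau))\cdot x(\tau)$ is integrable on $[0,T]$, and $x$ has a representative $\tilde x$ with left and right limits $\tilde x_-(t),\tilde x_+(t)$ at every $t\in[0,T]$, with the convention $\tilde x_-(0):=\tilde x_+(0)$, $\tilde x_+(T):=\tilde x_-(T)$. For all such choices, for every Borel set $B$ the map $(x,u)\mapsto\nu_{(\tilde x,u)}(B)$ is measurable (up to null sets), the formula $$\mathcal V(B)=\int\nu_{(\tilde x,u)}(B)\,\mathrm d\Pi(x_0,u_0,x,u)$$ defines a positive bounded Radon measure $\mathcal V\in\mathcal M_b^+(0,T)$, and for all $0\le s\le t\le T$ the functions $\overline E(t,\tilde x_+(t),u(t))$, $\overline E(s,\tilde x_-(s),u(s))$ and $\int_s^t[\partial_tE(\tau,x(\tau))-f(u(\tau))\cdot x(\tau)]\,\mathrm d\tau$ of $(x,u)$ are $\Pi^*$-integrable and $$\int\overline E(t,\tilde x_+(t),u(t))\,\mathrm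 d\Pi^*+\mathcal V([s,t])=\int\Big\{\overline E(s,\tilde x_-(s),u(s))+\int_s^t\big[\partial_tE(\tau,x(\tau))-f(u(\tau))\cdot x(\tau)\big]\,\mathrm d\tau\Big\}\,\mathrm d\Pi^*,$$ where $\mathcal V([s,t])$ means $\mathcal V([s,t]\cap(0,T))$. -/

import Mathlib

open MeasureTheory Set Filter Topology
open scoped ENNReal BoundedContinuousFunction

noncomputable section

/-- The state space `ℝ^d` with its Euclidean norm. -/
abbrev Vec (d : ℕ) : Type := EuclideanSpace ℝ (Fin d)

/-- The partial derivative `∂_t E(t,x)`; one-sided at the endpoints of `[0,T]`. -/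
def dtE {d : ℕ} (T : ℝ) (E : ℝ → Vec d → ℝ) (t : ℝ) (x : Vec d) : ℝ :=
  derivWithin (fun τ => E τ x) (Icc 0 T) t

/-- The spatial gradient `∇_x E(t,x)`. -/
def gradE {d : ℕ} (E : ℝ → Vec d → ℝ) (t : ℝ) (x : Vec d) : Vec d :=
  gradient (E t) x

/-- The set `C(t,u) = {x : ∇_x E(t,x) = u}`. -/
def critSet {d : ℕ} (E : ℝ → Vec d → ℝ) (t : ℝ) (u : Vec d) : Set (Vec d) :=
  {x | gradE E t x = u}

/-- The standing assumptions on the energy `E : [0,T] × ℝ^d → ℝ` (only the values of `E` at times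
in `[0,T]` matter). -/
structure EnergyAssumptions {d : ℕ} (T : ℝ) (E : ℝ → Vec d → ℝ) : Prop where
  /-- `E` is of class `C^1` on `[0,T] × ℝ^d`. -/
  contDiff : ContDiffOn ℝ 1 (fun q : ℝ × Vec d => E q.1 q.2) (Icc 0 T ×ˢ univ)
  /-- `∇_x E` is locally Lipschitz in `x`, uniformly in `t ∈ [0,T]`. -/
  grad_lipschitz : ∀ R : ℝ, ∃ L : NNReal, ∀ t ∈ Icc 0 T,
    LipschitzOnWith L (gradE E t) (Metric.closedBall 0 R)
  /-- `|∂_t E| ≤ C₁ + C₂ E`. -/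
  power_bound : ∃ C₁ > 0, ∃ C₂ > 0, ∀ t ∈ Icc 0 T, ∀ x : Vec d,
    |dtE T E t x| ≤ C₁ + C₂ * E t x
  /-- `C₃ |x|^q - C₄ ≤ E` for some `q > 1`. -/
  coercive : ∃ C₃ > 0, ∃ C₄ > 0, ∃ q : ℝ, 1 < q ∧ ∀ t ∈ Icc 0 T, ∀ x : Vec d,
    C₃ * ‖x‖ ^ q - C₄ ≤ E t x
  /-- All the sets `C(t,u)` consist of isolated points. -/
  isolated : ∀ t ∈ Icc 0 T, ∀ u : Vec d, ∀ x ∈ critSet E t u,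
    ∃ r > 0, critSet E t u ∩ Metric.ball x r = {x}

/-- The assumptions on the control field: locally Lipschitz with linear growth. -/
structure ControlAssumptions {d : ℕ} (f : Vec d → Vec d) : Prop where
  locallyLipschitz : LocallyLipschitz f
  linear_growth : ∃ C : ℝ, ∀ u, ‖f u‖ ≤ C * (1 + ‖u‖)

/-- The corrected energy `Ē(t,x,u) = E(t,x) - u · x`. -/
def Ebar {d : ℕ} (E : ℝ → Vec d → ℝ) (t : ℝ) (x u : Vec d) : ℝ :=
  E t x - inner ℝ u x

/-- Lebesgue measure on the interval `[0,T]`. -/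
def leb (T : ℝ) : Measure (Icc (0 : ℝ) T) :=
  Measure.comap (fun t : Icc (0 : ℝ) T => (t : ℝ)) volume

instance isFiniteMeasure_leb (T : ℝ) : IsFiniteMeasure (leb T) := by
  constructor
  rw [leb, comap_subtype_coe_apply measurableSet_Icc]
  exact (measure_mono (fun _ h => by simpa using h)).trans_lt (measure_Icc_lt_top (a := (0 : ℝ)) (b := T))

/-- `Λ = C([0,T]; ℝ^d)` with the topology of uniform convergence. -/
abbrev ContCurve (d : ℕ) (T : ℝ) : Type := C(Icc (0 : ℝ) T, Vec d)

/-- `Γ_T^p = L^p([0,T]; ℝ^d)`. -/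
abbrev LpCurve (d : ℕ) (p : ℝ≥0∞) (T : ℝ) : Type := Lp (Vec d) p (leb T)

instance instMeasurableSpaceContCurve (d : ℕ) (T : ℝ) : MeasurableSpace (ContCurve d T) :=
  borel _

instance instBorelSpaceContCurve (d : ℕ) (T : ℝ) : BorelSpace (ContCurve d T) := ⟨rfl⟩

instance instMeasurableSpaceLpCurve (d : ℕ) (p : ℝ≥0∞) [Fact (1 ≤ p)] (T : ℝ) :
    MeasurableSpace (LpCurve d p T) :=
  borel _

instance instBorelSpaceLpCurve (d : ℕ) (p : ℝ≥0∞) [Fact (1 ≤ p)] (T : ℝ) :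
    BorelSpace (LpCurve d p T) := ⟨rfl⟩

/-- `Γ_T^p × Λ`. -/
abbrev PairSpace (d : ℕ) (p : ℝ≥0∞) (T : ℝ) : Type := LpCurve d p T × ContCurve d T

/-- `ℝ^d × ℝ^d × Γ_T^p × Λ`. -/
abbrev PathSpace (d : ℕ) (p : ℝ≥0∞) (T : ℝ) : Type := Vec d × Vec d × PairSpace d p T

/-- A continuous curve on `[0,T]`, extended to `ℝ` by constants (so that one can differentiate). -/
def extend {d : ℕ} {T : ℝ} (hT : 0 < T) (x : ContCurve d T) : ℝ → Vec d :=
  IccExtend hT.le x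

/-- `(x,u)` solves `ε ẋ = -∇_x E(t,x) + u`, `u̇ = f(u)` on `[0,T]` with
`(x(0),u(0)) = z₀`. -/
structure IsSolution {d : ℕ} {T : ℝ} (hT : 0 < T) (E : ℝ → Vec d → ℝ) (f : Vec d → Vec d)
    (ε : ℝ) (z₀ : Vec d × Vec d) (x u : ContCurve d T) : Prop where
  ode_x : ∀ t : Icc (0 : ℝ) T,
    HasDerivWithinAt (extend hT x) (ε⁻¹ • (-gradE E t (x t) + u t)) (Icc 0 T) t
  ode_u : ∀ t : Icc (0 : ℝ) T, HasDerivWithinAt (extend hT u) (f (u t)) (Icc 0 T) t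
  init_x : extend hT x 0 = z₀.1
  init_u : extend hT u 0 = z₀.2

/-- The flow `z₀ ↦ Y_ε(z₀) = (x_ε(·), u_ε(·))`, the solution with initial datum `z₀`
(which exists and is unique under the standing assumptions, for `ε > 0`). -/
def flow {d : ℕ} {T : ℝ} (hT : 0 < T) (E : ℝ → Vec d → ℝ) (f : Vec d → Vec d)
    (ε : ℝ) (z₀ : Vec d × Vec d) : ContCurve d T × ContCurve d T :=
  Classical.epsilon fun w => IsSolution hT E f ε z₀ w.1 w.2

/-- The class in `L^p([0,T]; ℝ^d)` of a continuous curve. -/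
def toLpCurve {d : ℕ} {T : ℝ} (p : ℝ≥0∞) [Fact (1 ≤ p)] (x : ContCurve d T) : LpCurve d p T :=
  ContinuousMap.toLp p (leb T) ℝ x

/-- `Π_ε`, the law of `(x₀, u₀, x_ε(·), u_ε(·))` when `(x₀,u₀)` has law `η₀`. -/
def pathLaw {d : ℕ} {T : ℝ} (hT : 0 < T) (E : ℝ → Vec d → ℝ) (f : Vec d → Vec d)
    (p : ℝ≥0∞) [Fact (1 ≤ p)] (η₀ : Measure (Vec d × Vec d)) (ε : ℝ) :
    Measure (PathSpace d p T) :=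
  η₀.map fun z => (z.1, z.2, toLpCurve p (flow hT E f ε z).1, (flow hT E f ε z).2)

/-- A sequence of positive numbers tending to zero. -/
def IsVanishing (ε : ℕ → ℝ) : Prop :=
  (∀ n, 0 < ε n) ∧ Tendsto ε atTop (𝓝 0)

/-- `P` is a narrow accumulation point of `Π_ε` as `ε → 0`. -/
def IsNarrowLimitPoint {d : ℕ} {T : ℝ} (hT : 0 < T) (E : ℝ → Vec d → ℝ) (f : Vec d → Vec d)
    (p : ℝ≥0∞) [Fact (1 ≤ p)] (η₀ : Measure (Vec d × Vec d)) (P : Measure (PathSpace d p T)) :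
    Prop :=
  ∃ ε : ℕ → ℝ, IsVanishing ε ∧ ∀ φ : PathSpace d p T →ᵇ ℝ,
    Tendsto (fun n => ∫ ω, φ ω ∂(pathLaw hT E f p η₀ (ε n))) atTop (𝓝 (∫ ω, φ ω ∂P))

/-- The dissipation measure
`(ε/2 |ẋ|² + 1/(2ε) |∇_x E(·,x) - u|²) 𝓛¹` on the open interval `(0,T)`
(as a measure on `ℝ` that does not charge the complement). -/
def dissipation {d : ℕ} {T : ℝ} (hT : 0 < T) (E : ℝ → Vec d → ℝ) (ε : ℝ)
    (x u : ContCurve d T) : Measure ℝ :=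
  (volume.restrict (Ioo 0 T)).withDensity fun t => ENNReal.ofReal
    (ε / 2 * ‖deriv (extend hT x) t‖ ^ 2
      + 1 / (2 * ε) * ‖gradE E t (extend hT x t) - extend hT u t‖ ^ 2)

/-- Weak* convergence in `M_b(0,T)`, the dual of `C_0(0,T)`. A function in `C_0(0,T)` is the same
as a continuous function on `ℝ` that vanishes outside `(0,T)`. -/
def WeakStarTendsto (T : ℝ) (μ : ℕ → Measure ℝ) (ν : Measure ℝ) : Prop :=
  ∀ φ : ℝ → ℝ, Continuous φ → (∀ t, t ∉ Ioo 0 T → φ t = 0) →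
    Tendsto (fun n => ∫ t, φ t ∂(μ n)) atTop (𝓝 (∫ t, φ t ∂ν))

/-- `μ ∈ M_b^+(0,T)`, as a measure on `ℝ` that does not charge the complement of `(0,T)`. -/
structure IsFinitePositiveOn (T : ℝ) (μ : Measure ℝ) : Prop where
  finite : IsFiniteMeasure μ
  null_compl : μ (Ioo 0 T)ᶜ = 0

/-- `ν` is a dissipation measure of the limit evolution `(x,u) ∈ Γ_T^p × Λ`: the curve `(x,u)` is
the limit in `Γ_T^p × Λ` of solutions `(x_n,u_n)`, for a vanishing sequence `ε_n` and a convergent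
sequence of initial data, and `ν ∈ M_b^+(0,T)` is the weak* limit of the measures
`(ε_n/2 |ẋ_n|² + 1/(2ε_n) |∇_x E(·,x_n) - u_n|²) 𝓛¹`. -/
def IsDissipationMeasure {d : ℕ} {T : ℝ} (hT : 0 < T) (E : ℝ → Vec d → ℝ) (f : Vec d → Vec d)
    (p : ℝ≥0∞) [Fact (1 ≤ p)] (w : PairSpace d p T) (ν : Measure ℝ) : Prop :=
  IsFinitePositiveOn T ν ∧
  ∃ (ε : ℕ → ℝ) (z : ℕ → Vec d × Vec d) (z₀ : Vec d × Vec d) (x u : ℕ → ContCurve d T),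
    IsVanishing ε ∧ Tendsto z atTop (𝓝 z₀) ∧
    (∀ n, IsSolution hT E f (ε n) (z n) (x n) (u n)) ∧
    Tendsto (fun n => (toLpCurve p (x n), u n)) atTop (𝓝 w) ∧
    WeakStarTendsto T (fun n => dissipation hT E (ε n) (x n) (u n)) ν

/-- `xt` is a representative of the class `x ∈ Γ_T^p` with left limits `xm t` and right limits
`xp t` at all `t ∈ [0,T]`. As `x` carries no information outside `[0,T]`, at an endpoint the
missing one-sided limit is, by convention, the existing one. -/
structure IsRegulatedRep {d : ℕ} {p : ℝ≥0∞} {T : ℝ} (x : LpCurve d p T)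
    (xt xm xp : Icc (0 : ℝ) T → Vec d) : Prop where
  ae_eq : (x : Icc (0 : ℝ) T → Vec d) =ᵐ[leb T] xt
  left_lim : ∀ t : Icc (0 : ℝ) T, 0 < (t : ℝ) → Tendsto xt (𝓝[<] t) (𝓝 (xm t))
  right_lim : ∀ t : Icc (0 : ℝ) T, (t : ℝ) < T → Tendsto xt (𝓝[>] t) (𝓝 (xp t))
  left_zero : ∀ t : Icc (0 : ℝ) T, (t : ℝ) = 0 → xm t = xp t
  right_top : ∀ t : Icc (0 : ℝ) T, (t : ℝ) = T → xp t = xm t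

/-- The power `∂_t E(τ,x(τ)) - f(u(τ)) · x(τ)`. -/
def power {d : ℕ} {p : ℝ≥0∞} {T : ℝ} (E : ℝ → Vec d → ℝ) (f : Vec d → Vec d)
    (w : PairSpace d p T) (τ : Icc (0 : ℝ) T) : ℝ :=
  dtE T E τ (w.1 τ) - inner ℝ (f (w.2 τ)) (w.1 τ)

/-- The marginal `Π*` of `Π` on `Γ_T^p × Λ`. -/
def pairMarginal {d : ℕ} {p : ℝ≥0∞} [Fact (1 ≤ p)] {T : ℝ} (P : Measure (PathSpace d p T)) :
    Measure (PairSpace d p T) :=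
  P.map fun ω => ω.2.2

end

/-! ### Regularity of the energy and the chain rule for `Ebar`. -/

section Regularity

variable {d : ℕ} {T : ℝ} {E : ℝ → Vec d → ℝ}

/-! For ε > 0 the chain rule along a solution gives d/dt Ē = ∂_tE − f(u)·x − ε⁻¹|∇_xE − u|². Since
εẋ = −(∇_xE − u), the last term is exactly the dissipation density (`IsSolution.dissipation_eq`,
`IsSolution.energy_identity`). Superlinear coercivity and Gronwall bound solutions uniformly in ε
(`exists_bound_isSolution`), and then the identity bounds the total dissipation
(`exists_bound_dissipation`).

A point of supp Π* is a limit of solutions started in a compact carrier of η₀: every ball around it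
has positive limit mass, hence contains trajectories with arbitrarily small ε
(`exists_solutions_tendsto_of_mem_support`). Weak* compactness then yields a dissipation measure ν
(`exists_isDissipationMeasure_of_mem_support`).

The integral of |∇_xE − u|² is ε times the dissipation and tends to 0, so the limit curve is
critical almost everywhere (`SolutionSequence.ae_crit`). At almost all times a ≤ b the energies
converge, and semicontinuity on open and closed intervals gives the balance up to atoms of ν at a
and b (`SolutionSequence.energy_bounds`). Critical points are isolated, so leaving one of them means
traversing an annulus where the force is bounded below, which costs a fixed amount of dissipation
(`SolutionSequence.crossing`). As ν is finite, its mass on (a,t) vanishes when a increases to t;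
hence one-sided cluster values are unique and x is regulated (`IsLimitCurve.exists_isRegulatedRep`).
Letting a tend to s from the left and b to t from the right, the open and the closed intervals both
converge to [s,t], and the two bounds meet in an exact balance (`IsLimitCurve.energy_balance`).

All terms of that balance other than ν([s,t]) are determined by (x,u), so ν is unique
(`IsDissipationMeasure.unique`). The balance also gives measurability: one-sided energies are limits
of averages over shrinking neighbourhoods, which are continuous functionals on bounded sets of
curves (`measurable_indicator_essential_limit`), so the distribution function of ν is measurable in
the curve (`measurable_dissipationMeasure`). The measure 𝒱 is the resulting mixture, and integrating
the balance over curves gives the claim (`exists_mean_field_balance`). -/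

/-- The total derivative of the energy, as a function on `[0,T] × ℝ^d`. -/
noncomputable def energyFDeriv (T : ℝ) (E : ℝ → Vec d → ℝ) (t : ℝ) (x : Vec d) :
    ℝ × Vec d →L[ℝ] ℝ :=
  fderivWithin ℝ (fun q : ℝ × Vec d => E q.1 q.2) (Icc 0 T ×ˢ univ) (t, x)

lemma EnergyAssumptions.hasFDerivWithinAt (hE : EnergyAssumptions T E) {t : ℝ}
    (ht : t ∈ Icc 0 T) (x : Vec d) :
    HasFDerivWithinAt (fun q : ℝ × Vec d => E q.1 q.2) (energyFDeriv T E t x)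
      (Icc 0 T ×ˢ univ) (t, x) :=
  ((hE.contDiff.differentiableOn one_ne_zero) (t, x) ⟨ht, mem_univ _⟩).hasFDerivWithinAt

lemma EnergyAssumptions.dtE_eq (hT : 0 < T) (hE : EnergyAssumptions T E) {t : ℝ}
    (ht : t ∈ Icc 0 T) (x : Vec d) : dtE T E t x = energyFDeriv T E t x (1, 0) := by
  have h : HasDerivWithinAt (fun τ : ℝ => (τ, x)) ((1 : ℝ), (0 : Vec d)) (Icc 0 T) t :=
    (hasDerivWithinAt_id t _).prodMk (hasDerivWithinAt_const _ _ _)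
  have hm : MapsTo (fun τ : ℝ => (τ, x)) (Icc 0 T) (Icc 0 T ×ˢ univ) := fun τ hτ => ⟨hτ, mem_univ _⟩
  exact ((hE.hasFDerivWithinAt ht x).comp_hasDerivWithinAt t h hm).derivWithin
    (uniqueDiffOn_Icc hT t ht)

lemma EnergyAssumptions.hasFDerivAt (hE : EnergyAssumptions T E) {t : ℝ}
    (ht : t ∈ Icc 0 T) (x : Vec d) :
    HasFDerivAt (E t) ((energyFDeriv T E t x).comp (ContinuousLinearMap.inr ℝ ℝ (Vec d))) x := by
  have h : HasFDerivWithinAt (fun y : Vec d => (t, y)) (ContinuousLinearMap.inr ℝ ℝ (Vec d))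
      univ x := (hasFDerivAt_prodMk_right t x).hasFDerivWithinAt
  exact ((hE.hasFDerivWithinAt ht x).comp x h
    (fun y _ => ⟨ht, mem_univ _⟩)).hasFDerivAt univ_mem

lemma EnergyAssumptions.gradE_eq (hE : EnergyAssumptions T E) {t : ℝ}
    (ht : t ∈ Icc 0 T) (x : Vec d) :
    gradE E t x = (InnerProductSpace.toDual ℝ (Vec d)).symm
      ((energyFDeriv T E t x).comp (ContinuousLinearMap.inr ℝ ℝ (Vec d))) := by
  rw [gradE, gradient, (hE.hasFDerivAt ht x).fderiv]

lemma EnergyAssumptions.inner_gradE (hE : EnergyAssumptions T E) {t : ℝ}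
    (ht : t ∈ Icc 0 T) (x v : Vec d) :
    inner ℝ (gradE E t x) v = energyFDeriv T E t x (0, v) := by
  rw [hE.gradE_eq ht, InnerProductSpace.toDual_symm_apply]
  simp

lemma EnergyAssumptions.continuous_energyFDeriv (hT : 0 < T) (hE : EnergyAssumptions T E) :
    Continuous fun q : Icc (0 : ℝ) T × Vec d => energyFDeriv T E q.1 q.2 := by
  have h := hE.contDiff.continuousOn_fderivWithin
    ((uniqueDiffOn_Icc hT).prod (uniqueDiffOn_univ (E := Vec d))) le_rfl
  exact h.comp_continuous (f := fun q : Icc (0 : ℝ) T × Vec d => ((q.1 : ℝ), q.2))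
    (by fun_prop) fun q => ⟨q.1.2, mem_univ _⟩

lemma EnergyAssumptions.continuous_energy (hE : EnergyAssumptions T E) :
    Continuous fun q : Icc (0 : ℝ) T × Vec d => E q.1 q.2 :=
  hE.contDiff.continuousOn.comp_continuous
    (f := fun q : Icc (0 : ℝ) T × Vec d => ((q.1 : ℝ), q.2))
    (by fun_prop) fun q => ⟨q.1.2, mem_univ _⟩

lemma EnergyAssumptions.continuous_dtE (hT : 0 < T) (hE : EnergyAssumptions T E) :
    Continuous fun q : Icc (0 : ℝ) T × Vec d => dtE T E q.1 q.2 := by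
  have h := (hE.continuous_energyFDeriv hT).clm_apply
    (continuous_const (y := ((1 : ℝ), (0 : Vec d))))
  exact h.congr fun q => (hE.dtE_eq hT q.1.2 q.2).symm

lemma EnergyAssumptions.continuous_gradE (hT : 0 < T) (hE : EnergyAssumptions T E) :
    Continuous fun q : Icc (0 : ℝ) T × Vec d => gradE E q.1 q.2 := by
  have h := (InnerProductSpace.toDual ℝ (Vec d)).symm.continuous.comp
    ((hE.continuous_energyFDeriv hT).clm_comp
      (continuous_const (y := ContinuousLinearMap.inr ℝ ℝ (Vec d))))
  exact h.congr fun q => (hE.gradE_eq q.1.2 q.2).symm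

lemma EnergyAssumptions.continuous_Ebar (hE : EnergyAssumptions T E) :
    Continuous fun q : Icc (0 : ℝ) T × Vec d × Vec d => Ebar E q.1 q.2.1 q.2.2 := by
  have h : Continuous fun q : Icc (0 : ℝ) T × Vec d × Vec d => E q.1 q.2.1 :=
    hE.continuous_energy.comp (continuous_fst.prodMk continuous_snd.fst)
  exact h.sub (continuous_snd.snd.inner continuous_snd.fst)

/-- Chain rule for the corrected energy along a curve. -/
lemma EnergyAssumptions.hasDerivWithinAt_Ebar (hT : 0 < T) (hE : EnergyAssumptions T E)
    {t : ℝ} (ht : t ∈ Icc 0 T) {X U : ℝ → Vec d} {V W : Vec d}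
    (hX : HasDerivWithinAt X V (Icc 0 T) t) (hU : HasDerivWithinAt U W (Icc 0 T) t) :
    HasDerivWithinAt (fun τ => Ebar E τ (X τ) (U τ))
      (dtE T E t (X t) - inner ℝ W (X t) + inner ℝ (gradE E t (X t) - U t) V) (Icc 0 T) t := by
  have h : HasDerivWithinAt (fun τ : ℝ => (τ, X τ)) ((1 : ℝ), V) (Icc 0 T) t :=
    (hasDerivWithinAt_id t _).prodMk hX
  have h1 := (hE.hasFDerivWithinAt ht (X t)).comp_hasDerivWithinAt (f := fun τ : ℝ => (τ, X τ)) t h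
    (fun τ hτ => ⟨hτ, mem_univ _⟩)
  have h2 := h1.sub (hU.inner ℝ hX)
  refine h2.congr_deriv ?_
  have : ((1 : ℝ), V) = (1, 0) + (0, V) := by simp
  rw [this, map_add, ← hE.dtE_eq hT ht, ← hE.inner_gradE ht, inner_sub_left]
  ring

end Regularity

/-! ### Extension of curves to the real line. -/

section Curves

variable {d : ℕ} {T : ℝ}

lemma continuous_extend (hT : 0 < T) (x : ContCurve d T) : Continuous (extend hT x) :=
  x.continuous.Icc_extend'

lemma extend_of_mem (hT : 0 < T) (x : ContCurve d T) {t : ℝ} (ht : t ∈ Icc 0 T) :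
    extend hT x t = x ⟨t, ht⟩ :=
  IccExtend_of_mem hT.le x ht

lemma extend_coe (hT : 0 < T) (x : ContCurve d T) (t : Icc (0 : ℝ) T) :
    extend hT x t = x t :=
  IccExtend_val hT.le x t

end Curves

/-! ### A priori bounds uniform in ε, and existence of solutions. -/

section Apriori

variable {d : ℕ} {T : ℝ} {E : ℝ → Vec d → ℝ} {f : Vec d → Vec d}

/-- A superlinear power dominates every linear function. -/
lemma exists_mul_le_rpow_add {C q N : ℝ} (hC : 0 < C) (hq : 1 < q) (hN : 0 < N) :
    ∃ c, 0 ≤ c ∧ ∀ r : ℝ, 0 ≤ r → N * r ≤ C * r ^ q + c := by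
  set r₀ : ℝ := (N / C) ^ (q - 1)⁻¹ with hr₀
  have hr₀0 : 0 < r₀ := by positivity
  have hpow : r₀ ^ (q - 1) = N / C := by
    rw [hr₀, ← Real.rpow_mul (by positivity), inv_mul_cancel₀ (by linarith), Real.rpow_one]
  refine ⟨N * r₀, by positivity, fun r hr => ?_⟩
  rcases le_total r r₀ with h | h
  · have : 0 ≤ C * r ^ q := by positivity
    nlinarith
  · have hr0 : 0 < r := hr₀0.trans_le h
    have h1 : r₀ ^ (q - 1) ≤ r ^ (q - 1) :=
      Real.rpow_le_rpow hr₀0.le h (by linarith)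
    have h2 : r ^ q = r ^ (q - 1) * r := by
      rw [← Real.rpow_add_one hr0.ne']; simp
    have h3 : N ≤ C * r ^ (q - 1) := by
      rw [hpow, div_le_iff₀ hC] at h1; linarith
    have h4 : N * r ≤ C * r ^ q := by
      rw [h2, ← mul_assoc]; exact mul_le_mul_of_nonneg_right h3 hr
    have : 0 ≤ N * r₀ := by positivity
    linarith

/-- The growth exponent exceeds 1, so any linear term, in particular u·x and f(u)·x with u bounded,
can be absorbed into the energy. -/
lemma EnergyAssumptions.exists_linear_bound (hE : EnergyAssumptions T E) {N : ℝ} (hN : 0 < N) :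
    ∃ c, 0 ≤ c ∧ ∀ t ∈ Icc 0 T, ∀ x : Vec d, N * ‖x‖ ≤ E t x + c := by
  obtain ⟨C₃, hC₃, C₄, hC₄, q, hq, h⟩ := hE.coercive
  obtain ⟨c, hc, h'⟩ := exists_mul_le_rpow_add hC₃ hq hN
  refine ⟨c + C₄, by positivity, fun t ht x => ?_⟩
  linarith [h t ht x, h' ‖x‖ (norm_nonneg x)]

lemma hasDerivWithinAt_Ici_of_Icc {F : Type*} [NormedAddCommGroup F] [NormedSpace ℝ F]
    {a b t : ℝ} {g : ℝ → F} {g' : F} (h : HasDerivWithinAt g g' (Icc a b) t)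
    (ht : t ∈ Ico a b) : HasDerivWithinAt g g' (Ici t) t :=
  h.mono_of_mem_nhdsWithin (Icc_mem_nhdsGE_of_mem ht)

/-- A priori bound for curves along which the energy decreases up to the power of the external
forces. -/
lemma EnergyAssumptions.exists_apriori_bound (hT : 0 < T) (hE : EnergyAssumptions T E)
    {C : ℝ} (hC : 0 ≤ C) {R : ℝ} (hR : 0 ≤ R) :
    ∃ M : ℝ, ∀ X U V W : ℝ → Vec d,
      (∀ t ∈ Icc 0 T, HasDerivWithinAt X (V t) (Icc 0 T) t) →
      (∀ t ∈ Icc 0 T, HasDerivWithinAt U (W t) (Icc 0 T) t) →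
      (∀ t ∈ Icc 0 T, inner ℝ (gradE E t (X t) - U t) (V t) ≤ 0) →
      (∀ t ∈ Icc 0 T, ‖W t‖ ≤ C * (1 + ‖U t‖)) → ‖X 0‖ ≤ R → ‖U 0‖ ≤ R →
      ∀ t ∈ Icc 0 T, ‖X t‖ ≤ M ∧ ‖U t‖ ≤ M := by
  obtain ⟨C₁, hC₁, C₂, hC₂, hpow⟩ := hE.power_bound
  set Mu : ℝ := gronwallBound R C C T with hMu
  have hMu0 : 0 ≤ Mu := by
    have := gronwallBound_mono hR hC hC hT.le
    rw [gronwallBound_x0] at this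
    exact hR.trans this
  -- The factor 2 makes |u·x| at most half of E + c₁, so that E ≤ 2Ē + c₁. Adding 1 only keeps the
  -- slopes positive.
  obtain ⟨c₁, hc₁, h1⟩ := hE.exists_linear_bound (N := 2 * Mu + 1) (by positivity)
  obtain ⟨c₂, hc₂, h2⟩ := hE.exists_linear_bound (N := C * (1 + Mu) + 1) (by positivity)
  obtain ⟨c₃, hc₃, h3⟩ := hE.exists_linear_bound (N := 1) one_pos
  obtain ⟨δ, hδ⟩ := ((isCompact_closedBall (0 : Vec d) R).prod
    (isCompact_closedBall (0 : Vec d) R)).exists_bound_of_continuousOn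
      (f := fun q : Vec d × Vec d => Ebar E 0 q.1 q.2)
      ((hE.continuous_Ebar.comp (Continuous.prodMk (continuous_const
        (y := (⟨0, left_mem_Icc.2 hT.le⟩ : Icc (0 : ℝ) T))) continuous_id)).continuousOn)
  have hδ0 : 0 ≤ δ := (norm_nonneg _).trans
    (hδ (0, 0) ⟨by simpa using hR, by simpa using hR⟩)
  -- From d/dt Ē ≤ C₁ + C₂E + C(1+Mu)|x| ≤ (C₂+1)E + C₁ + c₂ and E ≤ 2Ē + c₁ one gets d/dt Ē ≤ k₂Ē +
  -- k₁.
  set k₂ : ℝ := 2 * (C₂ + 1) with hk₂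
  set k₁ : ℝ := (C₂ + 1) * c₁ + C₁ + c₂ with hk₁
  set B : ℝ := gronwallBound δ k₂ k₁ T with hB
  refine ⟨max Mu (2 * B + c₁ + c₃), fun X U V W hX hU hV hW hX0 hU0 => ?_⟩
  have hUb : ∀ t ∈ Icc 0 T, ‖U t‖ ≤ Mu := by
    intro t ht
    have h := norm_le_gronwallBound_of_norm_deriv_right_le (f := U) (f' := W) (δ := R) (K := C)
      (ε := C) (a := 0) (b := T) (fun t ht => (hU t ht).continuousWithinAt)
      (fun t ht => hasDerivWithinAt_Ici_of_Icc (hU t (Ico_subset_Icc_self ht)) ht) hU0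
      (fun t ht => (hW t (Ico_subset_Icc_self ht)).trans (by linarith)) t ht
    exact h.trans (gronwallBound_mono hR hC hC (by linarith [ht.2]))
  have hEb : ∀ t ∈ Icc 0 T, E t (X t) ≤ 2 * Ebar E t (X t) (U t) + c₁ := by
    intro t ht
    have hi := real_inner_le_norm (U t) (X t)
    have hm := mul_le_mul_of_nonneg_right (hUb t ht) (norm_nonneg (X t))
    have := h1 t ht (X t)
    have := norm_nonneg (X t)
    simp only [Ebar]
    linarith
  have hmain : ∀ t ∈ Icc 0 T, Ebar E t (X t) (U t) ≤ gronwallBound δ k₂ k₁ (t - 0) := by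
    refine le_gronwallBound_of_liminf_deriv_right_le
      (f' := fun t => dtE T E t (X t) - inner ℝ (W t) (X t)
        + inner ℝ (gradE E t (X t) - U t) (V t))
      (fun t ht => (hE.hasDerivWithinAt_Ebar hT ht (hX t ht) (hU t ht)).continuousWithinAt)
      (fun t ht r hr => HasDerivWithinAt.liminf_right_slope_le
        (hasDerivWithinAt_Ici_of_Icc (hE.hasDerivWithinAt_Ebar hT (Ico_subset_Icc_self ht)
          (hX t (Ico_subset_Icc_self ht)) (hU t (Ico_subset_Icc_self ht))) ht) hr)
      ?_ ?_
    · exact (le_abs_self _).trans (hδ (X 0, U 0) ⟨by simpa using hX0, by simpa using hU0⟩)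
    · intro t ht'
      have ht := Ico_subset_Icc_self ht'
      have ha := (le_abs_self _).trans (hpow t ht (X t))
      have hb : -inner ℝ (W t) (X t) ≤ ‖W t‖ * ‖X t‖ :=
        (neg_le_abs _).trans (abs_real_inner_le_norm _ _)
      have hw : ‖W t‖ ≤ C * (1 + Mu) :=
        (hW t ht).trans (mul_le_mul_of_nonneg_left (by linarith [hUb t ht]) hC)
      have hm := mul_le_mul_of_nonneg_right hw (norm_nonneg (X t))
      have hx := h2 t ht (X t)
      have hx0 := norm_nonneg (X t)
      have he : (C₂ + 1) * E t (X t) ≤ (C₂ + 1) * (2 * Ebar E t (X t) (U t) + c₁) :=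
        mul_le_mul_of_nonneg_left (hEb t ht) (by positivity)
      have hv := hV t ht
      simp only [hk₁, hk₂]
      linarith
  intro t ht
  refine ⟨le_max_of_le_right ?_, le_max_of_le_left (hUb t ht)⟩
  have hBt : Ebar E t (X t) (U t) ≤ B :=
    (hmain t ht).trans (gronwallBound_mono hδ0 (by positivity) (by positivity)
      (by linarith [ht.2]))
  linarith [h3 t ht (X t), hEb t ht]

/-- A Lipschitz cutoff function: `1` on the ball of radius `R`, `0` off the ball of radius
`R + 1`. -/
noncomputable def cutoff (R : ℝ) (x : Vec d) : ℝ := max 0 (min 1 (R + 1 - ‖x‖))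

lemma cutoff_nonneg (R : ℝ) (x : Vec d) : 0 ≤ cutoff R x := le_max_left _ _

lemma cutoff_le_one (R : ℝ) (x : Vec d) : cutoff R x ≤ 1 :=
  max_le zero_le_one (min_le_left _ _)

lemma cutoff_eq_one {R : ℝ} {x : Vec d} (h : ‖x‖ ≤ R) : cutoff R x = 1 := by
  rw [cutoff, min_eq_left (by linarith), max_eq_right zero_le_one]

lemma cutoff_eq_zero {R : ℝ} {x : Vec d} (h : R + 1 ≤ ‖x‖) : cutoff R x = 0 := by
  rw [cutoff, max_eq_left]
  exact (min_le_right _ _).trans (by linarith)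

lemma abs_cutoff_sub_le (R : ℝ) (x y : Vec d) : |cutoff R x - cutoff R y| ≤ ‖x - y‖ := by
  have h1 := abs_max_sub_max_le_abs (min 1 (R + 1 - ‖x‖)) (min 1 (R + 1 - ‖y‖)) 0
  have h2 := abs_min_sub_min_le_max 1 (R + 1 - ‖x‖) 1 (R + 1 - ‖y‖)
  have h3 := abs_norm_sub_norm_le y x
  rw [cutoff, cutoff, max_comm 0, max_comm 0]
  refine h1.trans (h2.trans (max_le (by simp) ?_))
  rw [norm_sub_rev x y, show R + 1 - ‖x‖ - (R + 1 - ‖y‖) = ‖y‖ - ‖x‖ by ring]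
  exact h3

/-- Solutions of an ordinary differential equation with a cutoff, on all of `[0,T]`. -/
lemma exists_cutoff_solution (hT : 0 < T) (w : ℝ → Vec d → Vec d)
    (hlip : ∀ R : ℝ, ∃ K : NNReal, ∀ t ∈ Icc 0 T, LipschitzOnWith K (w t) (Metric.closedBall 0 R))
    (hbdd : ∀ R : ℝ, ∃ B : ℝ, ∀ t ∈ Icc 0 T, ∀ x ∈ Metric.closedBall 0 R, ‖w t x‖ ≤ B)
    (hcont : ∀ x, ContinuousOn (fun t => w t x) (Icc 0 T)) (R : ℝ) (x₀ : Vec d) :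
    ∃ X : ℝ → Vec d, X 0 = x₀ ∧ ∀ t ∈ Icc 0 T,
      HasDerivWithinAt X (cutoff R (X t) • w t (X t)) (Icc 0 T) t := by
  obtain ⟨B, hB⟩ := hbdd (R + 1)
  set L : NNReal := B.toNNReal with hL
  have hglob : ∀ t ∈ Icc 0 T, ∀ x, ‖cutoff R x • w t x‖ ≤ L := by
    intro t ht x
    rw [norm_smul, Real.norm_of_nonneg (cutoff_nonneg R x)]
    rcases le_total (R + 1) ‖x‖ with h | h
    · rw [cutoff_eq_zero h]; simp
    · have := hB t ht x (by simpa using h)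
      calc cutoff R x * ‖w t x‖ ≤ 1 * ‖w t x‖ :=
            mul_le_mul_of_nonneg_right (cutoff_le_one R x) (norm_nonneg _)
        _ ≤ L := by rw [one_mul]; exact this.trans (Real.le_coe_toNNReal B)
  -- The field with cutoff has speed at most `L` everywhere, so in time `T` a solution stays within
  -- `L * T` of its start. This is the size condition that lets Picard–Lindelöf reach all of [0,T]
  -- in one step.
  set a : NNReal := L * T.toNNReal with ha
  obtain ⟨K, hK⟩ := hlip (‖x₀‖ + a)
  obtain ⟨B', hB'⟩ := hbdd (‖x₀‖ + a)
  have hsub : Metric.closedBall x₀ a ⊆ Metric.closedBall 0 (‖x₀‖ + a) := by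
    refine Metric.closedBall_subset_closedBall' ?_
    rw [dist_zero_right]; linarith
  have hPL : IsPicardLindelof (fun t x => cutoff R x • w t x)
      (⟨0, left_mem_Icc.2 hT.le⟩ : Icc (0 : ℝ) T) x₀ a 0 L (B'.toNNReal + K) := by
    refine ⟨fun t ht => ?_, fun x _ => by have := hcont x; fun_prop,
      fun t ht x _ => hglob t ht x, ?_⟩
    · refine LipschitzOnWith.of_dist_le_mul fun x hx y hy => ?_
      have hwx := hB' t ht x (hsub hx)
      have hd := (hK t ht).dist_le_mul x (hsub hx) y (hsub hy)
      have hc := abs_cutoff_sub_le R x y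
      rw [dist_eq_norm] at hd ⊢
      rw [dist_eq_norm] at hd ⊢
      have : cutoff R x • w t x - cutoff R y • w t y
          = (cutoff R x - cutoff R y) • w t x + cutoff R y • (w t x - w t y) := by
        rw [sub_smul, smul_sub]; abel
      rw [this]
      calc ‖(cutoff R x - cutoff R y) • w t x + cutoff R y • (w t x - w t y)‖
          ≤ |cutoff R x - cutoff R y| * ‖w t x‖ + cutoff R y * ‖w t x - w t y‖ := by
            refine (norm_add_le _ _).trans (le_of_eq ?_)
            rw [norm_smul, norm_smul, Real.norm_eq_abs, Real.norm_of_nonneg (cutoff_nonneg R y)]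
        _ ≤ ‖x - y‖ * B'.toNNReal + 1 * (K * ‖x - y‖) := by
            gcongr
            · exact hwx.trans (Real.le_coe_toNNReal B')
            · exact cutoff_le_one R y
        _ = ((B'.toNNReal + K : NNReal) : ℝ) * ‖x - y‖ := by push_cast; ring
    · simp [ha, hT.le]
  exact hPL.exists_eq_forall_mem_Icc_hasDerivWithinAt₀

lemma LocallyLipschitz.exists_lipschitzOnWith_closedBall (hf : LocallyLipschitz f) (R : ℝ) :
    ∃ K : NNReal, LipschitzOnWith K f (Metric.closedBall 0 R) :=
  (hf.locallyLipschitzOn (s := Metric.closedBall 0 R)).exists_lipschitzOnWith_of_compact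
    (isCompact_closedBall 0 R)

/-- Solutions of the perturbed gradient flow with a cutoff, for a given control. -/
lemma exists_cutoff_gradient_solution (hT : 0 < T) (hE : EnergyAssumptions T E) {ε : ℝ}
    (hε : 0 < ε) (U : ℝ → Vec d) (hU : Continuous fun t : Icc (0 : ℝ) T => U t) (M : ℝ)
    (x₀ : Vec d) :
    ∃ X : ℝ → Vec d, X 0 = x₀ ∧ ∀ t ∈ Icc 0 T, HasDerivWithinAt X
      (cutoff M (X t) • ε⁻¹ • (-gradE E t (X t) + U t)) (Icc 0 T) t := by
  have hwc : Continuous fun q : Icc (0 : ℝ) T × Vec d => ε⁻¹ • (-gradE E q.1 q.2 + U q.1) :=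
    continuous_const.fun_smul
      ((hE.continuous_gradE hT).fun_neg.fun_add (hU.comp continuous_fst))
  refine exists_cutoff_solution hT (fun t x => ε⁻¹ • (-gradE E t x + U t))
    (fun R => ?_) (fun R => ?_) (fun x => ?_) M x₀
  · obtain ⟨L, hL⟩ := hE.grad_lipschitz R
    refine ⟨ε⁻¹.toNNReal * L, fun t ht => LipschitzOnWith.of_dist_le_mul fun x hx y hy => ?_⟩
    have h := mul_le_mul_of_nonneg_left ((hL t ht).dist_le_mul x hx y hy) (inv_pos.2 hε).le
    rw [dist_smul₀, dist_add_right, dist_neg_neg, NNReal.coe_mul,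
      Real.coe_toNNReal _ (inv_pos.2 hε).le, Real.norm_of_nonneg (inv_pos.2 hε).le, mul_assoc]
    exact h
  · obtain ⟨B, hB⟩ := (isCompact_univ.prod (isCompact_closedBall (0 : Vec d) R)
      ).exists_bound_of_continuousOn hwc.continuousOn
    exact ⟨B, fun t ht x hx => hB (⟨t, ht⟩, x) ⟨mem_univ _, hx⟩⟩
  · have hx : Continuous fun t : Icc (0 : ℝ) T => (t, x) := by fun_prop
    exact continuousOn_iff_continuous_domRestrict.2 ((hwc.comp hx).congr fun t => rfl)

/-- The singularly perturbed system has a solution for all initial data. -/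
theorem exists_isSolution (hT : 0 < T) (hE : EnergyAssumptions T E) (hf : ControlAssumptions f)
    {ε : ℝ} (hε : 0 < ε) (z : Vec d × Vec d) :
    ∃ w : ContCurve d T × ContCurve d T, IsSolution hT E f ε z w.1 w.2 := by
  obtain ⟨C, hC⟩ := hf.linear_growth
  have hC0 : 0 ≤ C := by simpa using (norm_nonneg _).trans (hC 0)
  obtain ⟨M, hM⟩ := hE.exists_apriori_bound hT hC0 (R := max ‖z.1‖ ‖z.2‖) (by positivity)
  obtain ⟨U, hU0, hU⟩ := exists_cutoff_solution hT (fun _ => f)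
    (fun R => (hf.locallyLipschitz.exists_lipschitzOnWith_closedBall R).imp fun K hK _ _ => hK)
    (fun R => ((isCompact_closedBall 0 R).exists_bound_of_continuousOn
      hf.locallyLipschitz.continuous.continuousOn).imp fun B hB _ _ => hB)
    (fun _ => continuousOn_const) M z.2
  have hUc : Continuous fun t : Icc (0 : ℝ) T => U t :=
    ContinuousOn.comp_continuous (s := Icc 0 T) (fun t ht => (hU t ht).continuousWithinAt)
      continuous_subtype_val fun t => t.2
  obtain ⟨X, hX0, hX⟩ := exists_cutoff_gradient_solution hT hE hε U hUc M z.1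
  have hXc : Continuous fun t : Icc (0 : ℝ) T => X t :=
    ContinuousOn.comp_continuous (s := Icc 0 T) (fun t ht => (hX t ht).continuousWithinAt)
      continuous_subtype_val fun t => t.2
  -- The cutoff multiplies each velocity by a factor in [0,1], which preserves the sign of (∇_xE −
  -- U)·V and the growth bound. Hence the a priori bound `M` applies to the truncated system, and as
  -- the cutoff equals 1 up to radius `M` it was never active.
  have hb := hM X U _ _ hX hU
    (fun t _ => by
      have : -gradE E t (X t) + U t = -(gradE E t (X t) - U t) := by abel
      rw [this, inner_smul_right, inner_smul_right, inner_neg_right]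
      have h1 := real_inner_self_nonneg (x := gradE E t (X t) - U t)
      have h2 := mul_nonneg (cutoff_nonneg M (X t)) (mul_nonneg (inv_pos.2 hε).le h1)
      linarith)
    (fun t _ => by
      rw [norm_smul, Real.norm_of_nonneg (cutoff_nonneg _ _)]
      exact (mul_le_of_le_one_left (norm_nonneg _) (cutoff_le_one _ _)).trans (hC _))
    (by rw [hX0]; exact le_max_left _ _) (by rw [hU0]; exact le_max_right _ _)
  have hext : ∀ (Y : ℝ → Vec d) (hY : Continuous fun t : Icc (0 : ℝ) T => Y t),
      ∀ t ∈ Icc 0 T, extend hT ⟨_, hY⟩ t = Y t := fun Y hY t ht => extend_of_mem hT _ ht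
  refine ⟨(⟨_, hXc⟩, ⟨_, hUc⟩), fun t => ?_, fun t => ?_, ?_, ?_⟩
  · refine HasDerivWithinAt.congr ?_ (hext X hXc) (hext X hXc t t.2)
    have := hX t t.2
    rw [cutoff_eq_one (hb t t.2).1, one_smul] at this
    exact this
  · refine HasDerivWithinAt.congr ?_ (hext U hUc) (hext U hUc t t.2)
    have := hU t t.2
    rw [cutoff_eq_one (hb t t.2).2, one_smul] at this
    exact this
  · rw [hext X hXc 0 (left_mem_Icc.2 hT.le), hX0]
  · rw [hext U hUc 0 (left_mem_Icc.2 hT.le), hU0]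

theorem flow_isSolution (hT : 0 < T) (hE : EnergyAssumptions T E) (hf : ControlAssumptions f)
    {ε : ℝ} (hε : 0 < ε) (z : Vec d × Vec d) :
    IsSolution hT E f ε z (flow hT E f ε z).1 (flow hT E f ε z).2 :=
  Classical.epsilon_spec (exists_isSolution hT hE hf hε z)

/-- Solutions are bounded uniformly in `ε` and in bounded sets of initial data. -/
theorem exists_bound_isSolution (hT : 0 < T) (hE : EnergyAssumptions T E)
    (hf : ControlAssumptions f) (R : ℝ) :
    ∃ M : ℝ, 0 ≤ M ∧ ∀ (ε : ℝ) (z : Vec d × Vec d) (x u : ContCurve d T), 0 < ε → ‖z‖ ≤ R →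
      IsSolution hT E f ε z x u → ∀ t, ‖x t‖ ≤ M ∧ ‖u t‖ ≤ M := by
  obtain ⟨C, hC⟩ := hf.linear_growth
  have hC0 : 0 ≤ C := by simpa using (norm_nonneg _).trans (hC 0)
  obtain ⟨M, hM⟩ := hE.exists_apriori_bound hT hC0 (R := max R 0) (by positivity)
  refine ⟨max M 0, le_max_right _ _, fun ε z x u hε hz h t => ?_⟩
  have key := hM (extend hT x) (extend hT u)
    (fun t => ε⁻¹ • (-gradE E t (extend hT x t) + extend hT u t))
    (fun t => f (extend hT u t))
    (fun t ht => by simpa [extend_of_mem hT _ ht] using h.ode_x ⟨t, ht⟩)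
    (fun t ht => by simpa [extend_of_mem hT _ ht] using h.ode_u ⟨t, ht⟩)
    (fun t _ => by
      have : -gradE E t (extend hT x t) + extend hT u t
        = -(gradE E t (extend hT x t) - extend hT u t) := by abel
      rw [this, inner_smul_right, inner_neg_right]
      have h1 := real_inner_self_nonneg (x := gradE E t (extend hT x t) - extend hT u t)
      have h2 := mul_nonneg (inv_pos.2 hε).le h1
      linarith)
    (fun t _ => hC _)
    (by rw [h.init_x]; exact (norm_fst_le z).trans (hz.trans (le_max_left _ _)))
    (by rw [h.init_u]; exact (norm_snd_le z).trans (hz.trans (le_max_left _ _))) t t.2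
  rw [extend_coe, extend_coe] at key
  exact ⟨key.1.trans (le_max_left _ _), key.2.trans (le_max_left _ _)⟩

end Apriori

/-! ### Lebesgue measure on [0,T] against interval integrals. -/

section Lebesgue

variable {T : ℝ}

lemma measurePreserving_coe_leb (T : ℝ) :
    MeasurePreserving (fun t : Icc (0 : ℝ) T => (t : ℝ)) (leb T) (volume.restrict (Icc 0 T)) :=
  ⟨measurable_subtype_coe, map_comap_subtype_coe measurableSet_Icc volume⟩

lemma setIntegral_leb_eq_intervalIntegral {F : Type*} [NormedAddCommGroup F] [NormedSpace ℝ F]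
    (g : ℝ → F) {a b : Icc (0 : ℝ) T} (hab : a ≤ b) :
    ∫ τ in Icc a b, g τ ∂(leb T) = ∫ t in (a : ℝ)..b, g t := by
  have h := (measurePreserving_coe_leb T).setIntegral_preimage_emb
    (MeasurableEmbedding.subtype_coe measurableSet_Icc) g (Icc (a : ℝ) b)
  have hpre : (fun t : Icc (0 : ℝ) T => (t : ℝ)) ⁻¹' Icc (a : ℝ) b = Icc a b := rfl
  rw [hpre] at h
  rw [h, Measure.restrict_restrict measurableSet_Icc,
    inter_eq_left.2 (Icc_subset_Icc a.2.1 b.2.2), integral_Icc_eq_integral_Ioc,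
    intervalIntegral.integral_of_le hab]

end Lebesgue

/-! ### The energy identity and the cost of motion for ε > 0. -/

section EnergyIdentity

variable {d : ℕ} {T : ℝ} {E : ℝ → Vec d → ℝ} {f : Vec d → Vec d}

/-- The force `∇_x E(t,x(t)) - u(t)`, extended by constants outside `[0,T]`. -/
noncomputable def force (hT : 0 < T) (E : ℝ → Vec d → ℝ) (x u : ContCurve d T) (t : ℝ) : Vec d :=
  gradE E (projIcc 0 T hT.le t) (extend hT x t) - extend hT u t

lemma force_of_mem (hT : 0 < T) (x u : ContCurve d T) {t : ℝ} (ht : t ∈ Icc 0 T) :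
    force hT E x u t = gradE E t (extend hT x t) - extend hT u t := by
  rw [force, projIcc_of_mem hT.le ht]

lemma force_coe (hT : 0 < T) (x u : ContCurve d T) (t : Icc (0 : ℝ) T) :
    force hT E x u t = gradE E t (x t) - u t := by
  rw [force_of_mem hT x u t.2, extend_coe, extend_coe]

lemma EnergyAssumptions.continuous_force (hT : 0 < T) (hE : EnergyAssumptions T E)
    (x u : ContCurve d T) : Continuous (force hT E x u) :=
  ((hE.continuous_gradE hT).comp
    ((continuous_projIcc (h := hT.le)).prodMk (continuous_extend hT x))).sub (continuous_extend hT u)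

namespace IsSolution

variable {hT : 0 < T} {ε : ℝ} {z : Vec d × Vec d} {x u : ContCurve d T}

lemma hasDerivWithinAt_x (h : IsSolution hT E f ε z x u) {t : ℝ} (ht : t ∈ Icc 0 T) :
    HasDerivWithinAt (extend hT x) (-(ε⁻¹ • force hT E x u t)) (Icc 0 T) t := by
  have h1 := h.ode_x ⟨t, ht⟩
  refine h1.congr_deriv ?_
  rw [force_of_mem hT x u ht, extend_of_mem hT x ht, extend_of_mem hT u ht, ← smul_neg]
  congr 1
  abel

/-- By the equation ε|ẋ| is the norm of the force, so the two halves of the dissipation density are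
equal. -/
lemma dissipation_eq (h : IsSolution hT E f ε z x u) (hε : 0 < ε) :
    dissipation hT E ε x u = (volume.restrict (Ioo 0 T)).withDensity
      fun t => ENNReal.ofReal (ε⁻¹ * ‖force hT E x u t‖ ^ 2) := by
  refine withDensity_congr_ae ?_
  filter_upwards [ae_restrict_mem measurableSet_Ioo] with t ht
  have ht' := Ioo_subset_Icc_self ht
  rw [((h.hasDerivWithinAt_x ht').hasDerivAt (Icc_mem_nhds ht.1 ht.2)).deriv,
    ← force_of_mem hT x u ht', norm_neg, norm_smul, Real.norm_of_nonneg (inv_pos.2 hε).le]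
  congr 1
  field_simp
  ring

/-- The dissipation of a solution has a density, so endpoints do not matter; atoms can only appear
in the limit. -/
lemma dissipation_real_of_ae_eq (hE : EnergyAssumptions T E) (h : IsSolution hT E f ε z x u)
    (hε : 0 < ε) {a b : Icc (0 : ℝ) T} (hab : a ≤ b) {s : Set ℝ} (hs : MeasurableSet s)
    (hs' : s =ᵐ[volume] Ioc (a : ℝ) b) :
    (dissipation hT E ε x u).real s = ∫ t in (a : ℝ)..b, ε⁻¹ * ‖force hT E x u t‖ ^ 2 := by
  have hc := hE.continuous_force hT x u
  have hsub : (s ∩ Ioo 0 T : Set ℝ) =ᵐ[volume] Ioc (a : ℝ) b := by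
    have h1 : (s ∩ Ioo 0 T : Set ℝ) =ᵐ[volume] (Ioc (a : ℝ) b ∩ Ioc 0 T : Set ℝ) :=
      hs'.inter Ioo_ae_eq_Ioc
    rwa [inter_eq_left.2 (Ioc_subset_Ioc a.2.1 b.2.2)] at h1
  rw [h.dissipation_eq hε, measureReal_def, withDensity_apply _ hs,
    Measure.restrict_restrict hs, Measure.restrict_congr_set hsub,
    intervalIntegral.integral_of_le hab, integral_eq_lintegral_of_nonneg_ae]
  · exact ae_of_all _ fun t => by have := inv_pos.2 hε; positivity
  · exact (Continuous.aestronglyMeasurable (by fun_prop))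

lemma dissipation_real_Icc (hE : EnergyAssumptions T E) (h : IsSolution hT E f ε z x u)
    (hε : 0 < ε) {a b : Icc (0 : ℝ) T} (hab : a ≤ b) :
    (dissipation hT E ε x u).real (Icc a b)
      = ∫ t in (a : ℝ)..b, ε⁻¹ * ‖force hT E x u t‖ ^ 2 :=
  h.dissipation_real_of_ae_eq hE hε hab measurableSet_Icc Ioc_ae_eq_Icc.symm

lemma dissipation_real_Ioo (hE : EnergyAssumptions T E) (h : IsSolution hT E f ε z x u)
    (hε : 0 < ε) {a b : Icc (0 : ℝ) T} (hab : a ≤ b) :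
    (dissipation hT E ε x u).real (Ioo a b)
      = ∫ t in (a : ℝ)..b, ε⁻¹ * ‖force hT E x u t‖ ^ 2 :=
  h.dissipation_real_of_ae_eq hE hε hab measurableSet_Ioo Ioo_ae_eq_Ioc

lemma isFiniteMeasure_dissipation (hE : EnergyAssumptions T E) (h : IsSolution hT E f ε z x u)
    (hε : 0 < ε) : IsFiniteMeasure (dissipation hT E ε x u) := by
  rw [h.dissipation_eq hε]
  have hc := hE.continuous_force hT x u
  refine isFiniteMeasure_withDensity_ofReal (Integrable.hasFiniteIntegral ?_)
  have : Continuous fun t => ε⁻¹ * ‖force hT E x u t‖ ^ 2 := by fun_prop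
  exact (this.integrableOn_Icc (a := 0) (b := T)).mono_set Ioo_subset_Icc_self

lemma integral_power_eq (p : ℝ≥0∞) [Fact (1 ≤ p)] {a b : Icc (0 : ℝ) T} (hab : a ≤ b) :
    ∫ τ in Icc a b, power E f ((toLpCurve p x, u) : PairSpace d p T) τ ∂(leb T)
      = ∫ t in (a : ℝ)..b, (dtE T E (projIcc 0 T hT.le t) (extend hT x t)
          - inner ℝ (f (extend hT u t)) (extend hT x t)) := by
  rw [← setIntegral_leb_eq_intervalIntegral _ hab]
  refine integral_congr_ae (ae_restrict_of_ae ?_)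
  filter_upwards [ContinuousMap.coeFn_toLp (p := p) (leb T) (𝕜 := ℝ) x] with τ hτ
  simp only [power, toLpCurve, hτ, extend_coe, projIcc_val]

/-- The energy identity of the perturbed system. -/
lemma energy_identity (hE : EnergyAssumptions T E) (hf : ControlAssumptions f)
    (p : ℝ≥0∞) [Fact (1 ≤ p)] (h : IsSolution hT E f ε z x u) (hε : 0 < ε)
    {a b : Icc (0 : ℝ) T} (hab : a ≤ b) :
    Ebar E b (x b) (u b) + (dissipation hT E ε x u).real (Icc a b)
      = Ebar E a (x a) (u a)
        + ∫ τ in Icc a b, power E f ((toLpCurve p x, u) : PairSpace d p T) τ ∂(leb T) := by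
  have hc := hE.continuous_force hT x u
  have hfc := hf.locallyLipschitz.continuous
  have hxc := continuous_extend hT x
  have huc := continuous_extend hT u
  have hpc : Continuous fun t : ℝ => dtE T E (projIcc 0 T hT.le t) (extend hT x t)
      - inner ℝ (f (extend hT u t)) (extend hT x t) :=
    ((hE.continuous_dtE hT).comp ((continuous_projIcc (h := hT.le)).prodMk hxc)).sub
      ((hfc.comp huc).inner hxc)
  have hdc : Continuous fun t : ℝ => ε⁻¹ * ‖force hT E x u t‖ ^ 2 := by fun_prop
  have hder : ∀ t ∈ Icc 0 T, HasDerivWithinAt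
      (fun t => Ebar E t (extend hT x t) (extend hT u t))
      ((dtE T E (projIcc 0 T hT.le t) (extend hT x t)
      - inner ℝ (f (extend hT u t)) (extend hT x t)) - ε⁻¹ * ‖force hT E x u t‖ ^ 2)
      (Icc 0 T) t := by
    intro t ht
    have hu := h.ode_u ⟨t, ht⟩
    rw [← extend_of_mem hT u ht] at hu
    refine (hE.hasDerivWithinAt_Ebar hT ht (h.hasDerivWithinAt_x ht) hu).congr_deriv ?_
    rw [← force_of_mem hT x u ht, inner_neg_right, inner_smul_right, real_inner_self_eq_norm_sq,
      projIcc_of_mem hT.le ht]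
    ring
  have hsub : Icc (a : ℝ) b ⊆ Icc 0 T := Icc_subset_Icc a.2.1 b.2.2
  have key := intervalIntegral.integral_eq_sub_of_hasDerivAt_of_le (a := (a : ℝ)) (b := b)
    (f := fun t => Ebar E t (extend hT x t) (extend hT u t)) hab
    (fun t ht => ((hder t (hsub ht)).continuousWithinAt).mono hsub)
    (fun t ht => (hder t (hsub (Ioo_subset_Icc_self ht))).hasDerivAt
      (Icc_mem_nhds (a.2.1.trans_lt ht.1) (ht.2.trans_le b.2.2)))
    ((hpc.sub hdc).intervalIntegrable _ _)
  rw [intervalIntegral.integral_sub (hpc.intervalIntegrable _ _) (hdc.intervalIntegrable _ _)]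
    at key
  rw [h.dissipation_real_Icc hE hε hab, integral_power_eq (hT := hT) p hab]
  simp only [extend_coe] at key
  linarith

/-- The cost of moving while the force is bounded below. -/
lemma mul_norm_sub_le_dissipation (hE : EnergyAssumptions T E)
    (h : IsSolution hT E f ε z x u) (hε : 0 < ε) {a b : Icc (0 : ℝ) T} (hab : a ≤ b) {c : ℝ}
    (hc : 0 ≤ c) (hforce : ∀ t : Icc (0 : ℝ) T, t ∈ Icc a b → c ≤ ‖gradE E t (x t) - u t‖) :
    c * ‖x b - x a‖ ≤ (dissipation hT E ε x u).real (Icc a b) := by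
  have hcont := hE.continuous_force hT x u
  have hεi := inv_pos.2 hε
  have hsub : Icc (a : ℝ) b ⊆ Icc 0 T := Icc_subset_Icc a.2.1 b.2.2
  have h1 : Continuous fun t => -(ε⁻¹ • force hT E x u t) := by fun_prop
  have h2 : Continuous fun t => ε⁻¹ * ‖force hT E x u t‖ ^ 2 := by fun_prop
  have key := intervalIntegral.integral_eq_sub_of_hasDerivAt_of_le (a := (a : ℝ)) (b := b)
    (f := extend hT x) hab (continuous_extend hT x).continuousOn
    (fun t ht => (h.hasDerivWithinAt_x (hsub (Ioo_subset_Icc_self ht))).hasDerivAt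
      (Icc_mem_nhds (a.2.1.trans_lt ht.1) (ht.2.trans_le b.2.2)))
    (h1.intervalIntegrable _ _)
  rw [extend_coe, extend_coe] at key
  rw [h.dissipation_real_Icc hE hε hab, ← key]
  -- Since |ẋ| = ε⁻¹|force| and c ≤ |force|, one has c|ẋ| ≤ ε⁻¹|force|² pointwise.
  calc c * ‖∫ t in (a : ℝ)..b, -(ε⁻¹ • force hT E x u t)‖
      ≤ c * ∫ t in (a : ℝ)..b, ‖-(ε⁻¹ • force hT E x u t)‖ :=
        mul_le_mul_of_nonneg_left (intervalIntegral.norm_integral_le_integral_norm hab) hc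
    _ = ∫ t in (a : ℝ)..b, c * ‖-(ε⁻¹ • force hT E x u t)‖ := by
        rw [intervalIntegral.integral_const_mul]
    _ ≤ _ := by
        refine intervalIntegral.integral_mono_on hab
          ((continuous_const.mul h1.norm).intervalIntegrable _ _)
          (h2.intervalIntegrable _ _) fun t ht => ?_
        have hb := hforce ⟨t, hsub ht⟩ ht
        rw [← force_coe hT] at hb
        rw [norm_neg, norm_smul, Real.norm_of_nonneg hεi.le]
        calc c * (ε⁻¹ * ‖force hT E x u t‖) = ε⁻¹ * (c * ‖force hT E x u t‖) := by ring
          _ ≤ ε⁻¹ * (‖force hT E x u t‖ * ‖force hT E x u t‖) := by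
            have : c * ‖force hT E x u t‖ ≤ ‖force hT E x u t‖ * ‖force hT E x u t‖ :=
              mul_le_mul_of_nonneg_right hb (norm_nonneg _)
            exact mul_le_mul_of_nonneg_left this hεi.le
          _ = _ := by rw [sq]

end IsSolution

end EnergyIdentity

/-! ### Semicontinuity and compactness for weak* convergence on (0,T). -/

section WeakStar

variable {T : ℝ}

lemma tendsto_integral_of_eventually_eq_indicator {ν : Measure ℝ} [IsFiniteMeasure ν]
    {φ : ℕ → ℝ → ℝ} {s : Set ℝ} (hs : MeasurableSet s) (hφ : ∀ k, Continuous (φ k))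
    (h01 : ∀ k t, φ k t ∈ Icc (0 : ℝ) 1)
    (hlim : ∀ t, ∀ᶠ k in atTop, φ k t = s.indicator 1 t) :
    Tendsto (fun k => ∫ t, φ k t ∂ν) atTop (𝓝 (ν.real s)) := by
  rw [← integral_indicator_one hs]
  refine tendsto_integral_of_dominated_convergence (fun _ => 1)
    (fun k => (hφ k).aestronglyMeasurable) (integrable_const 1)
    (fun k => ae_of_all _ fun t => ?_) (ae_of_all _ fun t => ?_)
  · rw [Real.norm_of_nonneg (h01 k t).1]; exact (h01 k t).2
  · exact tendsto_const_nhds.congr' ((hlim t).mono fun k hk => hk.symm)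

lemma integrable_of_mem_Icc_zero_one {ν : Measure ℝ} [IsFiniteMeasure ν] {φ : ℝ → ℝ}
    (hφ : Continuous φ) (h01 : ∀ t, φ t ∈ Icc (0 : ℝ) 1) : Integrable φ ν :=
  Integrable.of_bound hφ.aestronglyMeasurable 1 (ae_of_all _ fun t => by
    rw [Real.norm_of_nonneg (h01 t).1]; exact (h01 t).2)

lemma eventually_one_le_natCast_mul {δ : ℝ} (hδ : 0 < δ) : ∀ᶠ k : ℕ in atTop, 1 ≤ (k : ℝ) * δ := by
  filter_upwards [tendsto_natCast_atTop_atTop.eventually_ge_atTop (1 / δ)] with k hk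
  rwa [div_le_iff₀ hδ] at hk

/-- Upper semicontinuity of the mass of compact intervals under weak* convergence. -/
lemma WeakStarTendsto.le_measureReal_Icc {μ : ℕ → Measure ℝ} {ν : Measure ℝ}
    [∀ n, IsFiniteMeasure (μ n)] [IsFiniteMeasure ν] (h : WeakStarTendsto T μ ν) {a b κ : ℝ}
    (ha : 0 < a) (hb : b < T) (hκ : ∀ᶠ n in atTop, κ ≤ (μ n).real (Icc a b)) :
    κ ≤ ν.real (Icc a b) := by
  -- Trapezoids above the indicator of [a,b], falling to 0 within distance 1/k. They are admissible
  -- tests once 1/k is at most the distance of [a,b] from the endpoints 0 and T.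
  set φ : ℕ → ℝ → ℝ := fun k t => max 0 (1 - k * max (max (a - t) (t - b)) 0) with hφ
  have hφc : ∀ k, Continuous (φ k) := fun k => by fun_prop
  have h01 : ∀ k t, φ k t ∈ Icc (0 : ℝ) 1 := fun k t => by
    have : 0 ≤ (k : ℝ) * max (max (a - t) (t - b)) 0 := by positivity
    exact ⟨le_max_left _ _, max_le zero_le_one (by linarith)⟩
  have hone : ∀ k, ∀ t ∈ Icc a b, φ k t = 1 := fun k t ht => by
    have : max (a - t) (t - b) ≤ 0 := max_le (by linarith [ht.1]) (by linarith [ht.2])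
    simp [hφ, max_eq_right this]
  have hzero : ∀ (k : ℕ) (δ t : ℝ), 1 ≤ k * δ → δ ≤ max (a - t) (t - b) → φ k t = 0 := by
    intro k δ t hk hδ
    refine max_eq_left ?_
    have : (k : ℝ) * δ ≤ k * max (max (a - t) (t - b)) 0 :=
      mul_le_mul_of_nonneg_left (hδ.trans (le_max_left _ _)) (Nat.cast_nonneg k)
    linarith
  have hlim : ∀ t, ∀ᶠ k in atTop, φ k t = (Icc a b).indicator 1 t := by
    intro t
    by_cases ht : t ∈ Icc a b
    · exact Eventually.of_forall fun k => by rw [hone k t ht, indicator_of_mem ht]; rfl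
    · have hpos : 0 < max (a - t) (t - b) := by
        rw [lt_max_iff]
        by_contra hcon
        push Not at hcon
        exact ht ⟨by linarith, by linarith⟩
      filter_upwards [eventually_one_le_natCast_mul hpos] with k hk
      rw [hzero k _ t hk le_rfl, indicator_of_notMem ht]
  refine ge_of_tendsto (tendsto_integral_of_eventually_eq_indicator measurableSet_Icc hφc h01 hlim)
    ?_
  have hδ : 0 < min a (T - b) := lt_min ha (by linarith)
  filter_upwards [eventually_one_le_natCast_mul hδ] with k hk
  refine ge_of_tendsto (h (φ k) (hφc k) fun t ht => hzero k _ t hk ?_) ?_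
  · rw [mem_Ioo, not_and_or, not_lt, not_lt] at ht
    rcases ht with ht | ht
    · exact (min_le_left _ _).trans (le_max_of_le_left (by linarith))
    · exact (min_le_right _ _).trans (le_max_of_le_right (by linarith))
  · filter_upwards [hκ] with n hn
    refine hn.trans ?_
    rw [← integral_indicator_one measurableSet_Icc]
    refine integral_mono ((integrable_const (1 : ℝ)).indicator measurableSet_Icc)
      (integrable_of_mem_Icc_zero_one (hφc k) (h01 k)) fun t => ?_
    by_cases ht : t ∈ Icc a b
    · rw [indicator_of_mem ht, hone k t ht]; rfl
    · rw [indicator_of_notMem ht]; exact (h01 k t).1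

/-- Lower semicontinuity of the mass of open intervals under weak* convergence. -/
lemma WeakStarTendsto.measureReal_Ioo_le {μ : ℕ → Measure ℝ} {ν : Measure ℝ}
    [∀ n, IsFiniteMeasure (μ n)] [IsFiniteMeasure ν] (h : WeakStarTendsto T μ ν) {a b L : ℝ}
    (ha : 0 ≤ a) (hb : b ≤ T) (hL : Tendsto (fun n => (μ n).real (Ioo a b)) atTop (𝓝 L)) :
    ν.real (Ioo a b) ≤ L := by
  -- Trapezoids below the indicator of (a,b). They vanish off (a,b), hence are admissible even if a
  -- = 0 or b = T.
  set φ : ℕ → ℝ → ℝ := fun k t => max 0 (min 1 (k * min (t - a) (b - t))) with hφ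
  have hφc : ∀ k, Continuous (φ k) := fun k => by fun_prop
  have h01 : ∀ k t, φ k t ∈ Icc (0 : ℝ) 1 := fun k t =>
    ⟨le_max_left _ _, max_le zero_le_one (min_le_left _ _)⟩
  have hzero : ∀ k, ∀ t, t ∉ Ioo a b → φ k t = 0 := by
    intro k t ht
    refine max_eq_left ((min_le_right _ _).trans
      (mul_nonpos_of_nonneg_of_nonpos (Nat.cast_nonneg k) ?_))
    rw [mem_Ioo, not_and_or, not_lt, not_lt] at ht
    rcases ht with ht | ht
    · exact (min_le_left _ _).trans (by linarith)
    · exact (min_le_right _ _).trans (by linarith)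
  have hlim : ∀ t, ∀ᶠ k in atTop, φ k t = (Ioo a b).indicator 1 t := by
    intro t
    by_cases ht : t ∈ Ioo a b
    · have hpos : 0 < min (t - a) (b - t) := lt_min (by linarith [ht.1]) (by linarith [ht.2])
      filter_upwards [eventually_one_le_natCast_mul hpos] with k hk
      rw [indicator_of_mem ht]
      simp [hφ, min_eq_left hk]
    · exact Eventually.of_forall fun k => by rw [hzero k t ht, indicator_of_notMem ht]
  refine le_of_tendsto (tendsto_integral_of_eventually_eq_indicator measurableSet_Ioo hφc h01 hlim)
    (Eventually.of_forall fun k => ?_)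
  refine le_of_tendsto_of_tendsto' (h (φ k) (hφc k) fun t ht => hzero k t fun ht' =>
    ht ⟨ha.trans_lt ht'.1, ht'.2.trans_le hb⟩) hL fun n => ?_
  rw [← integral_indicator_one measurableSet_Ioo]
  refine integral_mono (integrable_of_mem_Icc_zero_one (hφc k) (h01 k))
    ((integrable_const (1 : ℝ)).indicator measurableSet_Ioo) fun t => ?_
  by_cases ht : t ∈ Ioo a b
  · rw [indicator_of_mem ht]; exact (h01 k t).2
  · rw [indicator_of_notMem ht, hzero k t ht]

/-- Probability measures on a compact interval have a narrowly convergent subsequence. -/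
lemma exists_subseq_tendsto_probabilityMeasure (ρ : ℕ → ProbabilityMeasure ℝ)
    (hρ : ∀ n, (ρ n : Measure ℝ) (Icc 0 T)ᶜ = 0) :
    ∃ (ρ' : ProbabilityMeasure ℝ) (φ : ℕ → ℕ), StrictMono φ ∧
      Tendsto (ρ ∘ φ) atTop (𝓝 ρ') := by
  have htight : IsTightMeasureSet
      {((μ : ProbabilityMeasure ℝ) : Measure ℝ) | μ ∈ range ρ} := by
    rw [isTightMeasureSet_iff_exists_isCompact_measure_compl_le]
    rintro ε -
    refine ⟨Icc 0 T, isCompact_Icc, ?_⟩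
    rintro _ ⟨_, ⟨n, rfl⟩, rfl⟩
    rw [hρ n]; exact zero_le
  obtain ⟨ρ', -, φ, hφ, h⟩ := (isCompact_closure_of_isTightMeasureSet htight).tendsto_subseq
    (x := ρ) fun n => subset_closure (mem_range_self n)
  exact ⟨ρ', φ, hφ, h⟩

/-- Sequential weak* compactness of bounded sets of positive measures on `(0,T)`. -/
theorem exists_subseq_weakStarTendsto (μ : ℕ → Measure ℝ) (hnull : ∀ n, μ n (Ioo 0 T)ᶜ = 0)
    (C : NNReal) (hC : ∀ n, μ n univ ≤ C) :
    ∃ ν, IsFinitePositiveOn T ν ∧ ∃ φ : ℕ → ℕ, StrictMono φ ∧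
      WeakStarTendsto T (fun n => μ (φ n)) ν := by
  rcases le_or_gt T 0 with hT | hT
  · refine ⟨0, ⟨inferInstance, rfl⟩, id, strictMono_id, fun φ _ h0 => ?_⟩
    have : φ = 0 := funext fun t => h0 t fun ht => absurd (ht.1.trans ht.2) (not_lt.2 hT)
    simp [this]
  set c : NNReal := C + 1 with hc
  have hc0 : (c : ℝ≥0∞) ≠ 0 := by simp [hc]
  have hfin : ∀ n, IsFiniteMeasure (μ n) := fun n => ⟨(hC n).trans_lt ENNReal.coe_lt_top⟩
  have hmc : ∀ n, μ n univ ≤ c := fun n => (hC n).trans (by simp [hc])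
  -- The missing mass is placed at 0, where test functions vanish, to turn bounded measures into
  -- probability measures without affecting any test. Taking `C + 1` keeps the normalisation
  -- nonzero.
  set ρ₀ : ℕ → Measure ℝ := fun n => (c : ℝ≥0∞)⁻¹ •
    (μ n + ((c : ℝ≥0∞) - μ n univ) • Measure.dirac 0) with hρ₀
  have hprob : ∀ n, IsProbabilityMeasure (ρ₀ n) := fun n => ⟨by
    simp only [hρ₀, Measure.smul_apply, Measure.add_apply, smul_eq_mul, measure_univ, mul_one]
    rw [add_tsub_cancel_of_le (hmc n), ENNReal.inv_mul_cancel hc0 ENNReal.coe_ne_top]⟩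
  set ρ : ℕ → ProbabilityMeasure ℝ := fun n => ⟨ρ₀ n, hprob n⟩ with hρ
  obtain ⟨ρ', φ, hφ, hlim⟩ := exists_subseq_tendsto_probabilityMeasure (T := T) ρ fun n => by
    have h1 : μ n (Icc 0 T)ᶜ = 0 :=
      measure_mono_null (compl_subset_compl.2 Ioo_subset_Icc_self) (hnull n)
    have h2 : (Measure.dirac (0 : ℝ)) (Icc 0 T)ᶜ = 0 := by
      rw [Measure.dirac_apply' _ measurableSet_Icc.compl]
      simp [hT.le]
    simp [hρ, hρ₀, h1, h2]
  -- Mass that has collected at 0 or T is discarded; no test function sees it.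
  refine ⟨(c • (ρ' : Measure ℝ)).restrict (Ioo 0 T), ⟨inferInstance, ?_⟩, φ, hφ,
    fun g hg h0 => ?_⟩
  · rw [Measure.restrict_apply measurableSet_Ioo.compl]; simp
  have hsupp : HasCompactSupport g := HasCompactSupport.of_support_subset_isCompact
    (isCompact_Icc (a := 0) (b := T)) fun t ht => by
      by_contra hcon
      exact ht (h0 t fun h => hcon (Ioo_subset_Icc_self h))
  obtain ⟨B, hB⟩ := hsupp.exists_bound_of_continuous hg
  have hint := (ProbabilityMeasure.tendsto_iff_forall_integral_tendsto.1 hlim)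
    (BoundedContinuousFunction.ofNormedAddCommGroup g hg B hB)
  simp only [BoundedContinuousFunction.coe_ofNormedAddCommGroup] at hint
  rw [setIntegral_eq_integral_of_forall_compl_eq_zero fun t ht => h0 t ht,
    integral_smul_nnreal_measure]
  refine (hint.const_smul c).congr fun n => ?_
  have hi : Integrable g (μ (φ n)) := hg.integrable_of_hasCompactSupport hsupp
  change c • ∫ t, g t ∂(ρ₀ (φ n)) = _
  have hne : (c : ℝ≥0∞) - μ (φ n) univ ≠ ⊤ := ENNReal.sub_ne_top ENNReal.coe_ne_top
  rw [hρ₀, integral_smul_measure, integral_add_measure hi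
    ((integrable_dirac (by simp)).smul_measure hne), integral_smul_measure, integral_dirac,
    h0 0 (by simp), smul_zero, add_zero, NNReal.smul_def, smul_smul, ENNReal.toReal_inv,
    ENNReal.coe_toReal, mul_inv_cancel₀ (by positivity), one_smul]

end WeakStar

/-! ### Continuity of integral functionals on bounded sets of curves. -/

section Functionals

variable {d : ℕ} {T : ℝ} {p : ℝ≥0∞} [Fact (1 ≤ p)] {E : ℝ → Vec d → ℝ} {f : Vec d → Vec d}

/-- The pair `w` is bounded by `M`. -/
def CurveBound (M : ℝ) (w : PairSpace d p T) : Prop :=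
  (∀ᵐ τ ∂(leb T), ‖w.1 τ‖ ≤ M) ∧ ∀ τ, ‖w.2 τ‖ ≤ M

lemma curveBound_toLpCurve {M : ℝ} {x u : ContCurve d T} (h : ∀ t, ‖x t‖ ≤ M ∧ ‖u t‖ ≤ M) :
    CurveBound M ((toLpCurve p x, u) : PairSpace d p T) := by
  refine ⟨?_, fun τ => (h τ).2⟩
  filter_upwards [ContinuousMap.coeFn_toLp (p := p) (leb T) (𝕜 := ℝ) x] with τ hτ
  simp only [toLpCurve, hτ]
  exact (h τ).1

lemma exists_subseq_ae_tendsto {wn : ℕ → PairSpace d p T} {w : PairSpace d p T}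
    (h : Tendsto wn atTop (𝓝 w)) :
    ∃ φ : ℕ → ℕ, StrictMono φ ∧
      ∀ᵐ τ ∂(leb T), Tendsto (fun k => (wn (φ k)).1 τ) atTop (𝓝 (w.1 τ)) :=
  (tendstoInMeasure_of_tendsto_Lp ((continuous_fst.tendsto w).comp h)).exists_seq_tendsto_ae

lemma tendsto_snd_apply {ι : Type*} {l : Filter ι} {wn : ι → PairSpace d p T}
    {w : PairSpace d p T} (h : Tendsto wn l (𝓝 w)) (τ : Icc (0 : ℝ) T) :
    Tendsto (fun k => (wn k).2 τ) l (𝓝 (w.2 τ)) :=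
  (((continuous_eval_const (F := ContCurve d T) τ).comp continuous_snd).tendsto w).comp h

lemma CurveBound.of_tendsto {M : ℝ} {wn : ℕ → PairSpace d p T} {w : PairSpace d p T}
    (h : Tendsto wn atTop (𝓝 w)) (hb : ∀ᶠ n in atTop, CurveBound M (wn n)) : CurveBound M w := by
  obtain ⟨φ, hφ, hae⟩ := exists_subseq_ae_tendsto h
  refine ⟨?_, fun τ => le_of_tendsto (tendsto_snd_apply h τ).norm (hb.mono fun n hn => hn.2 τ)⟩
  have h2 : ∀ᵐ τ ∂(leb T), ∀ n, CurveBound M (wn n) → ‖(wn n).1 τ‖ ≤ M := by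
    rw [ae_all_iff]
    intro n
    by_cases hn : CurveBound M (wn n)
    · filter_upwards [hn.1] with τ hτ _ using hτ
    · exact ae_of_all _ fun τ h => absurd h hn
  filter_upwards [hae, h2] with τ hτ h2τ
  exact le_of_tendsto hτ.norm ((hφ.tendsto_atTop.eventually hb).mono fun k hk => h2τ _ hk)

omit [Fact (1 ≤ p)] in
lemma aestronglyMeasurable_comp_curve {F : Type*} [NormedAddCommGroup F]
    {Φ : Icc (0 : ℝ) T × Vec d × Vec d → F} (hΦ : Continuous Φ) (w : PairSpace d p T) :
    AEStronglyMeasurable (fun τ => Φ (τ, w.1 τ, w.2 τ)) (leb T) :=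
  hΦ.comp_aestronglyMeasurable (continuous_id.aestronglyMeasurable.prodMk
    ((Lp.aestronglyMeasurable w.1).prodMk w.2.continuous.aestronglyMeasurable))

lemma exists_bound_of_continuous_curve {F : Type*} [NormedAddCommGroup F]
    {Φ : Icc (0 : ℝ) T × Vec d × Vec d → F} (hΦ : Continuous Φ) (M : ℝ) :
    ∃ B, 0 ≤ B ∧ ∀ τ x u, ‖x‖ ≤ M → ‖u‖ ≤ M → ‖Φ (τ, x, u)‖ ≤ B := by
  obtain ⟨B, hB⟩ := (isCompact_univ.prod ((isCompact_closedBall (0 : Vec d) M).prod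
    (isCompact_closedBall (0 : Vec d) M))).exists_bound_of_continuousOn (f := Φ) hΦ.continuousOn
  exact ⟨max B 0, le_max_right _ _, fun τ x u hx hu => le_max_of_le_left
    (hB (τ, x, u) ⟨mem_univ _, by simpa using hx, by simpa using hu⟩)⟩

omit [Fact (1 ≤ p)] in
lemma CurveBound.ae_norm_le {F : Type*} [NormedAddCommGroup F]
    {Φ : Icc (0 : ℝ) T × Vec d × Vec d → F} {M B : ℝ}
    (hB : ∀ τ x u, ‖x‖ ≤ M → ‖u‖ ≤ M → ‖Φ (τ, x, u)‖ ≤ B) {w : PairSpace d p T}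
    (hw : CurveBound M w) : ∀ᵐ τ ∂(leb T), ‖Φ (τ, w.1 τ, w.2 τ)‖ ≤ B :=
  hw.1.mono fun τ hτ => hB τ _ _ hτ (hw.2 τ)

omit [Fact (1 ≤ p)] in
lemma CurveBound.integrable {F : Type*} [NormedAddCommGroup F]
    {Φ : Icc (0 : ℝ) T × Vec d × Vec d → F} (hΦ : Continuous Φ) {M : ℝ} {w : PairSpace d p T}
    (hw : CurveBound M w) : Integrable (fun τ => Φ (τ, w.1 τ, w.2 τ)) (leb T) := by
  obtain ⟨B, -, hB⟩ := exists_bound_of_continuous_curve hΦ M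
  exact Integrable.of_bound (aestronglyMeasurable_comp_curve hΦ w) B (hw.ae_norm_le hB)

/-- Integral functionals are sequentially continuous on bounded sets of curves. -/
lemma tendsto_integral_comp_curve {F : Type*} [NormedAddCommGroup F] [NormedSpace ℝ F]
    {Φ : Icc (0 : ℝ) T × Vec d × Vec d → F} (hΦ : Continuous Φ) {M : ℝ}
    {wn : ℕ → PairSpace d p T} {w : PairSpace d p T}
    (h : Tendsto wn atTop (𝓝 w)) (hb : ∀ᶠ n in atTop, CurveBound M (wn n))
    (I : Set (Icc (0 : ℝ) T)) :
    Tendsto (fun n => ∫ τ in I, Φ (τ, (wn n).1 τ, (wn n).2 τ) ∂(leb T)) atTop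
      (𝓝 (∫ τ in I, Φ (τ, w.1 τ, w.2 τ) ∂(leb T))) := by
  obtain ⟨B, -, hB⟩ := exists_bound_of_continuous_curve hΦ M
  -- L^p convergence gives almost everywhere convergence only along subsequences, so each
  -- subsequence is refined further.
  refine tendsto_of_subseq_tendsto fun ns hns => ?_
  obtain ⟨φ, hφ, hae⟩ := exists_subseq_ae_tendsto (h.comp hns)
  refine ⟨φ, ?_⟩
  have hns' := hns.comp hφ.tendsto_atTop
  refine tendsto_integral_filter_of_dominated_convergence (fun _ => B)
    (Eventually.of_forall fun n => (aestronglyMeasurable_comp_curve hΦ _).restrict)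
    ((hns'.eventually hb).mono fun n hn => ae_restrict_of_ae (hn.ae_norm_le hB))
    (integrable_const B) (ae_restrict_of_ae ?_)
  filter_upwards [hae] with τ hτ
  exact (hΦ.tendsto (τ, w.1 τ, w.2 τ)).comp
    (tendsto_const_nhds.prodMk_nhds (hτ.prodMk_nhds (tendsto_snd_apply (h.comp hns') τ)))

/-- Sequential continuity suffices because the space of curves is metrizable. This is the source of
all Borel measurability in the curve. -/
lemma continuousOn_integral_comp_curve {F : Type*} [NormedAddCommGroup F] [NormedSpace ℝ F]
    {Φ : Icc (0 : ℝ) T × Vec d × Vec d → F} (hΦ : Continuous Φ) {M : ℝ}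
    {S : Set (PairSpace d p T)} (hS : ∀ w ∈ S, CurveBound M w) (I : Set (Icc (0 : ℝ) T)) :
    ContinuousOn (fun w : PairSpace d p T => ∫ τ in I, Φ (τ, w.1 τ, w.2 τ) ∂(leb T)) S := by
  intro w _
  refine tendsto_of_seq_tendsto fun wn hwn => ?_
  rw [tendsto_nhdsWithin_iff] at hwn
  exact tendsto_integral_comp_curve hΦ hwn.1 (hwn.2.mono fun n hn => hS _ hn) I

lemma EnergyAssumptions.continuous_powerFun (hT : 0 < T) (hE : EnergyAssumptions T E)
    (hf : ControlAssumptions f) :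
    Continuous fun q : Icc (0 : ℝ) T × Vec d × Vec d =>
      dtE T E q.1 q.2.1 - inner ℝ (f q.2.2) q.2.1 := by
  have h : Continuous fun q : Icc (0 : ℝ) T × Vec d × Vec d => dtE T E q.1 q.2.1 :=
    (hE.continuous_dtE hT).comp (continuous_fst.prodMk continuous_snd.fst)
  exact h.sub ((hf.locallyLipschitz.continuous.comp continuous_snd.snd).inner continuous_snd.fst)

lemma EnergyAssumptions.continuous_forceFun (hT : 0 < T) (hE : EnergyAssumptions T E) :
    Continuous fun q : Icc (0 : ℝ) T × Vec d × Vec d => gradE E q.1 q.2.1 - q.2.2 := by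
  have h : Continuous fun q : Icc (0 : ℝ) T × Vec d × Vec d => gradE E q.1 q.2.1 :=
    (hE.continuous_gradE hT).comp (continuous_fst.prodMk continuous_snd.fst)
  exact h.sub continuous_snd.snd

/-- The total dissipation of solutions in a bounded set is bounded. -/
lemma exists_bound_dissipation (hT : 0 < T) (hE : EnergyAssumptions T E)
    (hf : ControlAssumptions f) (M : ℝ) :
    ∃ B : ℝ, ∀ (ε : ℝ) (z : Vec d × Vec d) (x u : ContCurve d T), 0 < ε →
      IsSolution hT E f ε z x u → (∀ t, ‖x t‖ ≤ M ∧ ‖u t‖ ≤ M) →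
      (dissipation hT E ε x u).real (Icc 0 T) ≤ B := by
  obtain ⟨B₁, -, hB₁⟩ := exists_bound_of_continuous_curve hE.continuous_Ebar M
  obtain ⟨B₂, -, hB₂⟩ := exists_bound_of_continuous_curve (hE.continuous_powerFun hT hf) M
  refine ⟨2 * B₁ + B₂ * (leb T).real univ, fun ε z x u hε h hb => ?_⟩
  set a : Icc (0 : ℝ) T := ⟨0, left_mem_Icc.2 hT.le⟩ with ha
  set b : Icc (0 : ℝ) T := ⟨T, right_mem_Icc.2 hT.le⟩ with hb'
  have hab : a ≤ b := hT.le
  -- The exponent is immaterial, as the identity concerns continuous curves only; 1 is an admissible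
  -- choice.
  have key := h.energy_identity hE hf 1 hε hab
  have h1 := (abs_le.1 (hB₁ a (x a) (u a) (hb a).1 (hb a).2)).2
  have h2 := (abs_le.1 (hB₁ b (x b) (u b) (hb b).1 (hb b).2)).1
  have huniv : Icc a b = univ := eq_univ_of_forall fun τ => ⟨τ.2.1, τ.2.2⟩
  have h3 := norm_integral_le_of_norm_le_const ((curveBound_toLpCurve (p := 1) hb).ae_norm_le
    (Φ := fun q => dtE T E q.1 q.2.1 - inner ℝ (f q.2.2) q.2.1) hB₂)
  have h4 := (le_abs_self _).trans h3
  rw [huniv, Measure.restrict_univ] at key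
  simp only [power] at key
  dsimp only at h1 h2
  linarith

end Functionals

/-! ### Crossing an annulus around an isolated critical point. -/

section Crossing

/-- A continuous function going from below `r₁` to above `r₂` crosses the strip between. -/
lemma exists_crossing {g : ℝ → ℝ} (hg : Continuous g) {a b r₁ r₂ : ℝ} (hab : a ≤ b)
    (hr : r₁ < r₂) (ha : g a ≤ r₁) (hb : r₂ ≤ g b) :
    ∃ σ σ', a ≤ σ ∧ σ ≤ σ' ∧ σ' ≤ b ∧ g σ = r₁ ∧ g σ' = r₂ ∧
      ∀ τ ∈ Icc σ σ', g τ ∈ Icc r₁ r₂ := by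
  -- σ' is the first time at level r₂ or above; σ below is the last time before σ' at level r₁ or
  -- below.
  obtain ⟨σ', ⟨⟨haσ', hσ'b⟩, hσ'⟩, hleast⟩ :=
    ((isCompact_Icc (a := a) (b := b)).inter_right (isClosed_le continuous_const hg)
      : IsCompact (Icc a b ∩ {τ | r₂ ≤ g τ})).exists_isLeast ⟨b, ⟨hab, le_rfl⟩, hb⟩
  have hσ'eq : g σ' = r₂ := by
    obtain ⟨c, hc, hgc⟩ := intermediate_value_Icc haσ' hg.continuousOn
      (⟨ha.trans hr.le, hσ'⟩ : r₂ ∈ Icc (g a) (g σ'))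
    have : σ' ≤ c := hleast ⟨⟨hc.1, hc.2.trans hσ'b⟩, hgc.ge⟩
    rwa [le_antisymm hc.2 this] at hgc
  obtain ⟨σ, ⟨⟨haσ, hσσ'⟩, hσ⟩, hgreatest⟩ :=
    ((isCompact_Icc (a := a) (b := σ')).inter_right (isClosed_le hg continuous_const)
      : IsCompact (Icc a σ' ∩ {τ | g τ ≤ r₁})).exists_isGreatest ⟨a, ⟨le_rfl, haσ'⟩, ha⟩
  have hσeq : g σ = r₁ := by
    obtain ⟨c, hc, hgc⟩ := intermediate_value_Icc hσσ' hg.continuousOn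
      (⟨hσ, hr.le.trans hσ'⟩ : r₁ ∈ Icc (g σ) (g σ'))
    have : c ≤ σ := hgreatest ⟨⟨haσ.trans hc.1, hc.2⟩, hgc.le⟩
    rwa [le_antisymm this hc.1] at hgc
  refine ⟨σ, σ', haσ, hσσ', hσ'b, hσeq, hσ'eq, fun τ hτ => ⟨?_, ?_⟩⟩
  · by_contra! hcon
    have : τ ≤ σ := hgreatest ⟨⟨haσ.trans hτ.1, hτ.2⟩, hcon.le⟩
    rw [le_antisymm this hτ.1, hσeq] at hcon
    exact lt_irrefl _ hcon
  · by_contra! hcon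
    have : σ' ≤ τ := hleast ⟨⟨haσ.trans hτ.1, hτ.2.trans hσ'b⟩, hcon.le⟩
    rw [le_antisymm hτ.2 this, hσ'eq] at hcon
    exact lt_irrefl _ hcon

/-- If b precedes a, the crossing is found for −g between the levels −r₂ and −r₁. -/
lemma exists_crossing_uIcc {g : ℝ → ℝ} (hg : Continuous g) {a b r₁ r₂ : ℝ}
    (hr : r₁ < r₂) (ha : g a ≤ r₁) (hb : r₂ ≤ g b) :
    ∃ σ σ', min a b ≤ σ ∧ σ ≤ σ' ∧ σ' ≤ max a b ∧ |g σ' - g σ| = r₂ - r₁ ∧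
      ∀ τ ∈ Icc σ σ', g τ ∈ Icc r₁ r₂ := by
  rcases le_total a b with hab | hab
  · obtain ⟨σ, σ', h1, h2, h3, h4, h5, h6⟩ := exists_crossing hg hab hr ha hb
    refine ⟨σ, σ', (min_le_left _ _).trans h1, h2, h3.trans (le_max_right _ _), ?_, h6⟩
    rw [h4, h5, abs_of_pos (by linarith)]
  · obtain ⟨σ, σ', h1, h2, h3, h4, h5, h6⟩ := exists_crossing (g := fun t => -g t) hg.neg hab
      (r₁ := -r₂) (r₂ := -r₁) (by linarith) (by simpa using hb) (by simpa using ha)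
    refine ⟨σ, σ', (min_le_right _ _).trans h1, h2, h3.trans (le_max_left _ _), ?_,
      fun τ hτ => ⟨by linarith [(h6 τ hτ).2], by linarith [(h6 τ hτ).1]⟩⟩
    have h4' : g σ = r₂ := by linarith
    have h5' : g σ' = r₁ := by linarith
    rw [h4', h5', abs_sub_comm, abs_of_pos (by linarith)]

variable {d : ℕ} {T : ℝ} {E : ℝ → Vec d → ℝ} {f : Vec d → Vec d}

/-- The force is bounded below in an annulus around an isolated critical point. -/
lemma EnergyAssumptions.exists_force_lower_bound (hT : 0 < T) (hE : EnergyAssumptions T E)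
    (u : ContCurve d T) (t : Icc (0 : ℝ) T) {y y' : Vec d} (hy : gradE E t y = u t) (hne : y' ≠ y) :
    ∃ c > 0, ∃ ρ > 0, 3 * ρ ≤ ‖y' - y‖ ∧ ∀ᶠ τ : Icc (0 : ℝ) T in 𝓝 t, ∀ ξ : Vec d,
      ‖ξ - y‖ ∈ Icc ρ (2 * ρ) → c < ‖gradE E τ ξ - u τ‖ := by
  obtain ⟨r, hr, hiso⟩ := hE.isolated t t.2 (u t) y hy
  have hd : 0 < ‖y' - y‖ := norm_pos_iff.2 (sub_ne_zero.2 hne)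
  -- A third of both radii: the annulus ρ ≤ |ξ − y| ≤ 2ρ lies in the ball of isolation, and points
  -- within ρ of y' are still at distance at least 2ρ from y.
  set ρ := min r ‖y' - y‖ / 3 with hρ
  have hρ0 : 0 < ρ := by positivity
  have hρr : 2 * ρ < r := by
    have := min_le_left r ‖y' - y‖
    rw [hρ] at hρ0 ⊢; linarith
  have hρd : 3 * ρ ≤ ‖y' - y‖ := by
    have := min_le_right r ‖y' - y‖
    rw [hρ]; linarith
  have hcont : Continuous fun q : Icc (0 : ℝ) T × Vec d => ‖gradE E q.1 q.2 - u q.1‖ :=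
    ((hE.continuous_gradE hT).sub (u.continuous.comp continuous_fst)).norm
  set K : Set (Vec d) := {ξ | ‖ξ - y‖ ∈ Icc ρ (2 * ρ)} with hK
  have hKc : IsCompact K := by
    refine (isCompact_closedBall y (2 * ρ)).of_isClosed_subset
      (isClosed_Icc.preimage (by fun_prop)) fun ξ hξ => ?_
    rw [mem_closedBall_iff_norm]; exact hξ.2
  obtain ⟨c, hc, hcK⟩ := hKc.exists_forall_le' (a := 0) (f := fun ξ => ‖gradE E t ξ - u t‖)
    (hcont.comp (Continuous.prodMk_right t)).continuousOn fun ξ hξ => by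
      rw [norm_pos_iff, sub_ne_zero]
      intro hcon
      have : ξ ∈ critSet E t (u t) ∩ Metric.ball y r :=
        ⟨hcon, by rw [mem_ball_iff_norm]; exact hξ.2.trans_lt hρr⟩
      rw [hiso, mem_singleton_iff] at this
      rw [this] at hξ
      simp only [hK, mem_ofPred_eq, sub_self, norm_zero, mem_Icc] at hξ
      linarith [hξ.1]
  -- Halving makes the bound strict, hence open in (τ, ξ); compactness of the annulus makes the
  -- neighbourhood of t uniform in ξ.
  refine ⟨c / 2, by positivity, ρ, hρ0, hρd, hKc.eventually_forall_of_forall_eventually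
    fun ξ hξ => ?_⟩
  exact (hcont.tendsto (t, ξ)).eventually
    (lt_mem_nhds ((half_lt_self hc).trans_le (hcK ξ hξ)))

end Crossing

/-! ### Properties inherited by limits of solutions. -/

section LimitCurve

variable {d : ℕ} {T : ℝ} {p : ℝ≥0∞} [Fact (1 ≤ p)] {E : ℝ → Vec d → ℝ} {f : Vec d → Vec d}

/-- The properties of the limits of solutions that are used below: outside of a null set the limit
curve is bounded and critical, the energy balance holds up to atoms, and oscillations near a
critical point cost a fixed amount of dissipation. -/
structure IsLimitCurve (E : ℝ → Vec d → ℝ) (f : Vec d → Vec d) (w : PairSpace d p T)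
    (ν : Measure ℝ) (M : ℝ) (A : Set (Icc (0 : ℝ) T)) : Prop where
  mem_ae : A ∈ ae (leb T)
  interior : ∀ a ∈ A, (a : ℝ) ∈ Ioo 0 T
  bound : ∀ a ∈ A, ‖w.1 a‖ ≤ M
  curveBound : CurveBound M w
  crit : ∀ a ∈ A, gradE E a (w.1 a) = w.2 a
  lower : ∀ a ∈ A, ∀ b ∈ A, a ≤ b → ν.real (Ioo a b) ≤
    Ebar E a (w.1 a) (w.2 a) - Ebar E b (w.1 b) (w.2 b) + ∫ τ in Icc a b, power E f w τ ∂(leb T)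
  upper : ∀ a ∈ A, ∀ b ∈ A, a ≤ b →
    Ebar E a (w.1 a) (w.2 a) - Ebar E b (w.1 b) (w.2 b) + ∫ τ in Icc a b, power E f w τ ∂(leb T)
      ≤ ν.real (Icc a b)
  crossing : ∀ t : Icc (0 : ℝ) T, ∀ y y' : Vec d, gradE E t y = w.2 t → y' ≠ y →
    ∃ c > 0, ∃ δ > 0, ∃ ρ > 0, ∀ a ∈ A, ∀ b ∈ A, dist a t < δ → dist b t < δ →
      dist (w.1 a) y < ρ → dist (w.1 b) y' < ρ → c ≤ ν.real (uIcc (a : ℝ) b)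

omit [Fact (1 ≤ p)] in
lemma IsLimitCurve.mono {w : PairSpace d p T} {ν : Measure ℝ} {M : ℝ}
    {A B : Set (Icc (0 : ℝ) T)} (h : IsLimitCurve E f w ν M A) (hB : B ∈ ae (leb T))
    (hBA : B ⊆ A) : IsLimitCurve E f w ν M B where
  mem_ae := hB
  interior a ha := h.interior a (hBA ha)
  bound a ha := h.bound a (hBA ha)
  curveBound := h.curveBound
  crit a ha := h.crit a (hBA ha)
  lower a ha b hb := h.lower a (hBA ha) b (hBA hb)
  upper a ha b hb := h.upper a (hBA ha) b (hBA hb)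
  crossing t y y' hy hne := by
    obtain ⟨c, hc, δ, hδ, ρ, hρ, h'⟩ := h.crossing t y y' hy hne
    exact ⟨c, hc, δ, hδ, ρ, hρ, fun a ha b hb => h' a (hBA ha) b (hBA hb)⟩

lemma leb_singleton (t : Icc (0 : ℝ) T) : leb T {t} = 0 := by
  rw [leb, comap_subtype_coe_apply measurableSet_Icc]
  simp

lemma ae_mem_Ioo_leb (T : ℝ) : ∀ᵐ t : Icc (0 : ℝ) T ∂(leb T), (t : ℝ) ∈ Ioo 0 T := by
  have h : ∀ᵐ s ∂(volume.restrict (Icc 0 T)), s ∈ Ioo 0 T := by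
    rw [← restrict_Ioo_eq_restrict_Icc]
    exact ae_restrict_mem measurableSet_Ioo
  exact (measurePreserving_coe_leb T).quasiMeasurePreserving.ae h

/-- Data of a sequence of solutions converging to `w`, pointwise almost everywhere. -/
structure SolutionSequence (hT : 0 < T) (E : ℝ → Vec d → ℝ) (f : Vec d → Vec d)
    (w : PairSpace d p T) (M : ℝ) (ε : ℕ → ℝ) (z : ℕ → Vec d × Vec d)
    (x u : ℕ → ContCurve d T) : Prop where
  vanishing : IsVanishing ε
  solution : ∀ n, IsSolution hT E f (ε n) (z n) (x n) (u n)
  bound : ∀ n t, ‖x n t‖ ≤ M ∧ ‖u n t‖ ≤ M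
  tendsto : Tendsto (fun n => ((toLpCurve p (x n), u n) : PairSpace d p T)) atTop (𝓝 w)
  tendsto_ae : ∀ᵐ τ ∂(leb T), Tendsto (fun n => x n τ) atTop (𝓝 (w.1 τ))

namespace SolutionSequence

variable {hT : 0 < T} {w : PairSpace d p T} {M : ℝ} {ε : ℕ → ℝ} {z : ℕ → Vec d × Vec d}
  {x u : ℕ → ContCurve d T} {ν : Measure ℝ}

lemma curveBound (h : SolutionSequence hT E f w M ε z x u) : CurveBound M w :=
  CurveBound.of_tendsto h.tendsto (Eventually.of_forall fun n => curveBound_toLpCurve (h.bound n))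

lemma tendstoUniformly (h : SolutionSequence hT E f w M ε z x u) {c : ℝ} (hc : 0 < c) :
    ∀ᶠ n in atTop, ∀ τ, ‖u n τ - w.2 τ‖ < c := by
  have h1 : Tendsto u atTop (𝓝 w.2) := (continuous_snd.tendsto w).comp h.tendsto
  filter_upwards [Metric.tendsto_nhds.1 h1 c hc] with n hn τ
  rw [← dist_eq_norm]
  exact (ContinuousMap.dist_apply_le_dist τ).trans_lt hn

/-- The limit curve is critical almost everywhere. -/
lemma ae_crit (hE : EnergyAssumptions T E) (hf : ControlAssumptions f)
    (h : SolutionSequence hT E f w M ε z x u) :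
    ∀ᵐ τ : Icc (0 : ℝ) T ∂(leb T), gradE E τ (w.1 τ) = w.2 τ := by
  obtain ⟨B, hB⟩ := exists_bound_dissipation hT hE hf M
  set a : Icc (0 : ℝ) T := ⟨0, left_mem_Icc.2 hT.le⟩ with ha
  set b : Icc (0 : ℝ) T := ⟨T, right_mem_Icc.2 hT.le⟩ with hb'
  have hab : a ≤ b := hT.le
  have huniv : Icc a b = univ := eq_univ_of_forall fun τ => ⟨τ.2.1, τ.2.2⟩
  have hΦ : Continuous fun q : Icc (0 : ℝ) T × Vec d × Vec d => ‖gradE E q.1 q.2.1 - q.2.2‖ ^ 2 :=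
    (hE.continuous_forceFun hT).norm.pow 2
  have hlim := tendsto_integral_comp_curve hΦ h.tendsto
    (Eventually.of_forall fun n => curveBound_toLpCurve (h.bound n)) (Icc a b)
  -- The squared force integrates to ε times a bounded quantity, hence vanishes in the limit.
  have heq : ∀ n, ∫ τ in Icc a b, ‖gradE E τ (toLpCurve p (x n) τ) - u n τ‖ ^ 2 ∂(leb T)
      = ε n * (dissipation hT E (ε n) (x n) (u n)).real (Icc a b) := by
    intro n
    have hε := h.vanishing.1 n
    rw [(h.solution n).dissipation_real_Icc hE hε hab, intervalIntegral.integral_const_mul,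
      ← mul_assoc, mul_inv_cancel₀ hε.ne', one_mul, ← setIntegral_leb_eq_intervalIntegral _ hab]
    refine integral_congr_ae (ae_restrict_of_ae ?_)
    filter_upwards [ContinuousMap.coeFn_toLp (p := p) (leb T) (𝕜 := ℝ) (x n)] with τ hτ
    simp only [toLpCurve, hτ, force_coe]
  have hzero : Tendsto (fun n => ∫ τ in Icc a b,
      ‖gradE E τ (toLpCurve p (x n) τ) - u n τ‖ ^ 2 ∂(leb T)) atTop (𝓝 0) := by
    have hB' : Tendsto (fun n => ε n * B) atTop (𝓝 0) := by
      simpa using h.vanishing.2.mul_const B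
    refine squeeze_zero (fun n => integral_nonneg fun τ => by positivity) (fun n => ?_) hB'
    rw [heq]
    exact mul_le_mul_of_nonneg_left
      (hB (ε n) (z n) (x n) (u n) (h.vanishing.1 n) (h.solution n) (h.bound n))
      (h.vanishing.1 n).le
  have hint := tendsto_nhds_unique hlim hzero
  rw [huniv, Measure.restrict_univ, integral_eq_zero_iff_of_nonneg
    (fun τ => by positivity) (h.curveBound.integrable hΦ)] at hint
  filter_upwards [hint] with τ hτ
  simpa [sub_eq_zero] using hτ

lemma le_measureReal_uIcc (hE : EnergyAssumptions T E)
    (h : SolutionSequence hT E f w M ε z x u) [IsFiniteMeasure ν]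
    (hν : WeakStarTendsto T (fun n => dissipation hT E (ε n) (x n) (u n)) ν)
    {a b : Icc (0 : ℝ) T} (ha : (a : ℝ) ∈ Ioo 0 T) (hb : (b : ℝ) ∈ Ioo 0 T) {c : ℝ}
    (hc : ∀ᶠ n in atTop, c ≤ (dissipation hT E (ε n) (x n) (u n)).real (uIcc (a : ℝ) b)) :
    c ≤ ν.real (uIcc (a : ℝ) b) := by
  have := fun n => (h.solution n).isFiniteMeasure_dissipation hE (h.vanishing.1 n)
  exact hν.le_measureReal_Icc (lt_min ha.1 hb.1) (max_lt ha.2 hb.2) hc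

/-- Energies and power pass to the limit in the energy identity, so the masses of [a,b] converge.
The weak* limit is only semicontinuous on intervals, whence the gap between open and closed. -/
lemma energy_bounds (hE : EnergyAssumptions T E) (hf : ControlAssumptions f)
    (h : SolutionSequence hT E f w M ε z x u) [IsFiniteMeasure ν]
    (hν : WeakStarTendsto T (fun n => dissipation hT E (ε n) (x n) (u n)) ν)
    {a b : Icc (0 : ℝ) T} (ha : (a : ℝ) ∈ Ioo 0 T) (hb : (b : ℝ) ∈ Ioo 0 T) (hab : a ≤ b)
    (hxa : Tendsto (fun n => x n a) atTop (𝓝 (w.1 a)))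
    (hxb : Tendsto (fun n => x n b) atTop (𝓝 (w.1 b))) :
    Ebar E a (w.1 a) (w.2 a) - Ebar E b (w.1 b) (w.2 b) + ∫ τ in Icc a b, power E f w τ ∂(leb T)
      ∈ Icc (ν.real (Ioo a b)) (ν.real (Icc a b)) := by
  have := fun n => (h.solution n).isFiniteMeasure_dissipation hE (h.vanishing.1 n)
  have hEb : ∀ c : Icc (0 : ℝ) T, Tendsto (fun n => x n c) atTop (𝓝 (w.1 c)) →
      Tendsto (fun n => Ebar E c (x n c) (u n c)) atTop (𝓝 (Ebar E c (w.1 c) (w.2 c))) :=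
    fun c hc => (hE.continuous_Ebar.tendsto (c, w.1 c, w.2 c)).comp
      (tendsto_const_nhds.prodMk_nhds (hc.prodMk_nhds (tendsto_snd_apply h.tendsto c)))
  have hpow := tendsto_integral_comp_curve (hE.continuous_powerFun hT hf) h.tendsto
    (Eventually.of_forall fun n => curveBound_toLpCurve (h.bound n)) (Icc a b)
  have hlim := ((hEb a hxa).sub (hEb b hxb)).add hpow
  have hid : ∀ n, (dissipation hT E (ε n) (x n) (u n)).real (Icc a b)
      = Ebar E a (x n a) (u n a) - Ebar E b (x n b) (u n b)
        + ∫ τ in Icc a b, power E f ((toLpCurve p (x n), u n) : PairSpace d p T) τ ∂(leb T) :=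
    fun n => by linarith [(h.solution n).energy_identity hE hf p (h.vanishing.1 n) hab]
  have hlim' : Tendsto (fun n => (dissipation hT E (ε n) (x n) (u n)).real (Icc a b)) atTop
      (𝓝 (Ebar E a (w.1 a) (w.2 a) - Ebar E b (w.1 b) (w.2 b)
        + ∫ τ in Icc a b, power E f w τ ∂(leb T))) :=
    hlim.congr fun n => (hid n).symm
  constructor
  · refine hν.measureReal_Ioo_le ha.1.le hb.2.le (hlim'.congr fun n => ?_)
    rw [(h.solution n).dissipation_real_Icc hE (h.vanishing.1 n) hab,
      (h.solution n).dissipation_real_Ioo hE (h.vanishing.1 n) hab]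
  · refine le_of_forall_lt fun c hc => ?_
    obtain ⟨c', hcc', hc'⟩ := exists_between hc
    exact hcc'.trans_le (hν.le_measureReal_Icc ha.1 hb.2
      ((hlim'.eventually (lt_mem_nhds hc')).mono fun n hn => hn.le))

/-- For large n the approximating curve is near y at one time and near y' at the other, so in
between it traverses the annulus. There the force is at least c/2, half of c being spent on
replacing the limit control by `u n`, and the distance covered is at least ρ. The bound survives in
ν because compact intervals are upper semicontinuous. -/
lemma crossing (hE : EnergyAssumptions T E)
    (h : SolutionSequence hT E f w M ε z x u) [IsFiniteMeasure ν]
    (hν : WeakStarTendsto T (fun n => dissipation hT E (ε n) (x n) (u n)) ν)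
    (t : Icc (0 : ℝ) T) {y y' : Vec d} (hy : gradE E t y = w.2 t) (hne : y' ≠ y) :
    ∃ c > 0, ∃ δ > 0, ∃ ρ > 0, ∀ a b : Icc (0 : ℝ) T, (a : ℝ) ∈ Ioo 0 T → (b : ℝ) ∈ Ioo 0 T →
      Tendsto (fun n => x n a) atTop (𝓝 (w.1 a)) → Tendsto (fun n => x n b) atTop (𝓝 (w.1 b)) →
      dist a t < δ → dist b t < δ →
      dist (w.1 a) y < ρ → dist (w.1 b) y' < ρ → c ≤ ν.real (uIcc (a : ℝ) b) := by
  obtain ⟨c, hc, ρ, hρ, hρd, hev⟩ := hE.exists_force_lower_bound hT w.2 t hy hne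
  obtain ⟨δ, hδ, hball⟩ := Metric.eventually_nhds_iff.1 hev
  refine ⟨c / 2 * ρ, by positivity, δ, hδ, ρ, hρ, fun a b ha hb hxa hxb hda hdb hya hyb => ?_⟩
  refine h.le_measureReal_uIcc hE hν ha hb ?_
  have hna : ∀ᶠ n in atTop, dist (x n a) y < ρ :=
    (hxa.dist tendsto_const_nhds).eventually (gt_mem_nhds hya)
  have hnb : ∀ᶠ n in atTop, dist (x n b) y' < ρ :=
    (hxb.dist tendsto_const_nhds).eventually (gt_mem_nhds hyb)
  filter_upwards [hna, hnb, h.tendstoUniformly (half_pos hc)] with n hna hnb hun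
  have := (h.solution n).isFiniteMeasure_dissipation hE (h.vanishing.1 n)
  set g : ℝ → ℝ := fun τ => ‖extend hT (x n) τ - y‖ with hg
  have hgc : Continuous g := ((continuous_extend hT (x n)).sub continuous_const).norm
  have hga : g a ≤ ρ := by
    simp only [hg, extend_coe, ← dist_eq_norm]; exact hna.le
  have hgb : 2 * ρ ≤ g b := by
    simp only [hg, extend_coe]
    have h1 := norm_sub_le_norm_sub_add_norm_sub y' (x n b) y
    rw [dist_eq_norm, norm_sub_rev] at hnb
    linarith
  obtain ⟨σ, σ', h1, h2, h3, h4, h5⟩ := exists_crossing_uIcc hgc (by linarith) hga hgb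
  have hσ : σ ∈ Icc 0 T := ⟨(le_min a.2.1 b.2.1).trans h1, h2.trans (h3.trans (max_le a.2.2 b.2.2))⟩
  have hσ' : σ' ∈ Icc 0 T := ⟨hσ.1.trans h2, h3.trans (max_le a.2.2 b.2.2)⟩
  have hcost := (h.solution n).mul_norm_sub_le_dissipation hE (h.vanishing.1 n)
    (a := ⟨σ, hσ⟩) (b := ⟨σ', hσ'⟩) h2 (c := c / 2) (half_pos hc).le fun τ hτ => by
      have hτt : dist τ t < δ := by
        rw [Subtype.dist_eq, Real.dist_eq, abs_lt] at hda hdb ⊢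
        have e1 : min (a : ℝ) b ≤ τ := h1.trans hτ.1
        have e2 : (τ : ℝ) ≤ max (a : ℝ) b := le_trans hτ.2 h3
        rw [min_le_iff] at e1
        rw [le_max_iff] at e2
        constructor
        · rcases e1 with e1 | e1 <;> linarith [hda.1, hdb.1]
        · rcases e2 with e2 | e2 <;> linarith [hda.2, hdb.2]
      have hgτ : ‖x n τ - y‖ ∈ Icc ρ (2 * ρ) := by
        have := h5 τ hτ
        simpa only [hg, extend_coe] using this
      have hlow := hball hτt (x n τ) hgτ
      have htri := norm_sub_le_norm_sub_add_norm_sub (gradE E τ (x n τ)) (u n τ) (w.2 τ)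
      linarith [hun τ]
  have hdist : ρ ≤ ‖x n ⟨σ', hσ'⟩ - x n ⟨σ, hσ⟩‖ := by
    have e := abs_norm_sub_norm_le (x n ⟨σ', hσ'⟩ - y) (x n ⟨σ, hσ⟩ - y)
    rw [sub_sub_sub_cancel_right, ← extend_of_mem hT, ← extend_of_mem hT] at e
    rw [← extend_of_mem hT, ← extend_of_mem hT]
    have : |g σ' - g σ| = 2 * ρ - ρ := h4
    simp only [hg] at this
    rw [this] at e
    linarith
  calc c / 2 * ρ ≤ c / 2 * ‖x n ⟨σ', hσ'⟩ - x n ⟨σ, hσ⟩‖ :=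
        mul_le_mul_of_nonneg_left hdist (half_pos hc).le
    _ ≤ _ := hcost
    _ ≤ _ := measureReal_mono (Icc_subset_Icc h1 h3)

theorem exists_isLimitCurve (hE : EnergyAssumptions T E) (hf : ControlAssumptions f)
    (h : SolutionSequence hT E f w M ε z x u) [IsFiniteMeasure ν]
    (hν : WeakStarTendsto T (fun n => dissipation hT E (ε n) (x n) (u n)) ν) :
    ∃ A, IsLimitCurve E f w ν M A := by
  have hmem : {τ : Icc (0 : ℝ) T | Tendsto (fun n => x n τ) atTop (𝓝 (w.1 τ)) ∧ (τ : ℝ) ∈ Ioo 0 T ∧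
      ‖w.1 τ‖ ≤ M ∧ gradE E τ (w.1 τ) = w.2 τ} ∈ ae (leb T) := by
    filter_upwards [h.tendsto_ae, ae_mem_Ioo_leb T, h.curveBound.1, h.ae_crit hE hf]
      with τ h1 h2 h3 h4 using ⟨h1, h2, h3, h4⟩
  refine ⟨_, hmem, fun a ha => ha.2.1, fun a ha => ha.2.2.1, h.curveBound, fun a ha => ha.2.2.2,
    fun a ha b hb hab => (h.energy_bounds hE hf hν ha.2.1 hb.2.1 hab ha.1 hb.1).1,
    fun a ha b hb hab => (h.energy_bounds hE hf hν ha.2.1 hb.2.1 hab ha.1 hb.1).2,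
    fun t y y' hy hne => ?_⟩
  obtain ⟨c, hc, δ, hδ, ρ, hρ, h'⟩ := h.crossing hE hν t hy hne
  exact ⟨c, hc, δ, hδ, ρ, hρ, fun a ha b hb => h' a b ha.2.1 hb.2.1 ha.1 hb.1⟩

end SolutionSequence

/-- Curves with a dissipation measure are limit curves in the sense above. -/
theorem IsDissipationMeasure.exists_isLimitCurve {hT : 0 < T} (hE : EnergyAssumptions T E)
    (hf : ControlAssumptions f) {w : PairSpace d p T} {ν : Measure ℝ}
    (h : IsDissipationMeasure hT E f p w ν) : ∃ M A, IsLimitCurve E f w ν M A := by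
  obtain ⟨hfin, ε, z, z₀, x, u, hε, hz, hsol, hlim, hν⟩ := h
  have := hfin.finite
  obtain ⟨R, hR⟩ := (Metric.isBounded_range_of_tendsto z hz).exists_norm_le
  obtain ⟨M, -, hM⟩ := exists_bound_isSolution hT hE hf R
  have hb : ∀ n t, ‖x n t‖ ≤ M ∧ ‖u n t‖ ≤ M := fun n =>
    hM (ε n) (z n) (x n) (u n) (hε.1 n) (hR _ (mem_range_self n)) (hsol n)
  obtain ⟨φ, hφ, hae⟩ := exists_subseq_ae_tendsto hlim
  have hφt := hφ.tendsto_atTop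
  have hseq : SolutionSequence hT E f w M (ε ∘ φ) (z ∘ φ) (x ∘ φ) (u ∘ φ) := by
    refine ⟨⟨fun n => hε.1 _, hε.2.comp hφt⟩, fun n => hsol _, fun n => hb _,
      hlim.comp hφt, ?_⟩
    have hcoe : ∀ᵐ τ ∂(leb T), ∀ n, toLpCurve p (x n) τ = x n τ := by
      rw [ae_all_iff]
      exact fun n => ContinuousMap.coeFn_toLp (p := p) (leb T) (𝕜 := ℝ) (x n)
    filter_upwards [hae, hcoe] with τ hτ hc
    exact hτ.congr fun k => hc _
  obtain ⟨A, hA⟩ := hseq.exists_isLimitCurve hE hf (ν := ν)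
    fun φ' hc h0 => (hν φ' hc h0).comp hφt
  exact ⟨M, A, hA⟩

end LimitCurve

/-! ### One-sided approach to a time, with the endpoint conventions. -/

section OneSided

variable {T : ℝ}

lemma leb_Ioo (a b : Icc (0 : ℝ) T) : leb T (Ioo a b) = ENNReal.ofReal (b - a) := by
  have h := (measurePreserving_coe_leb T).measure_preimage
    (measurableSet_Ioo (a := (a : ℝ)) (b := b)).nullMeasurableSet
  rw [Measure.restrict_apply measurableSet_Ioo, inter_eq_left.2
    (Ioo_subset_Icc_self.trans (Icc_subset_Icc a.2.1 b.2.2)), Real.volume_Ioo] at h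
  exact h

lemma leb_Ioo_pos {a b : Icc (0 : ℝ) T} (h : a < b) : 0 < leb T (Ioo a b) := by
  have h' : (a : ℝ) < b := h
  rw [leb_Ioo, ENNReal.ofReal_pos]
  linarith

lemma inter_nonempty_of_mem_ae {α : Type*} [MeasurableSpace α] {μ : Measure α} {s A : Set α}
    (hs : μ s ≠ 0) (hA : A ∈ ae μ) : (s ∩ A).Nonempty := by
  rw [nonempty_iff_ne_empty]
  intro hcon
  exact hs (measure_mono_null (disjoint_iff_inter_eq_empty.2 hcon).subset_compl_right
    (mem_ae_iff.1 hA))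

lemma neBot_nhdsLT_inf {A : Set (Icc (0 : ℝ) T)} (hA : A ∈ ae (leb T)) {t : Icc (0 : ℝ) T}
    (ht : 0 < (t : ℝ)) : NeBot (𝓝[<] t ⊓ 𝓟 A) := by
  rw [inf_principal_neBot_iff]
  intro U hU
  have h0 : (⟨0, le_rfl, t.2.1.trans t.2.2⟩ : Icc (0 : ℝ) T) < t := ht
  obtain ⟨l, hl, hlU⟩ := (mem_nhdsLT_iff_exists_Ioo_subset' h0).1 hU
  exact (inter_nonempty_of_mem_ae (leb_Ioo_pos hl).ne' hA).mono (inter_subset_inter_left _ hlU)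

lemma neBot_nhdsGT_inf {A : Set (Icc (0 : ℝ) T)} (hA : A ∈ ae (leb T)) {t : Icc (0 : ℝ) T}
    (ht : (t : ℝ) < T) : NeBot (𝓝[>] t ⊓ 𝓟 A) := by
  rw [inf_principal_neBot_iff]
  intro U hU
  have h0 : t < (⟨T, t.2.1.trans t.2.2, le_rfl⟩ : Icc (0 : ℝ) T) := ht
  obtain ⟨l, hl, hlU⟩ := (mem_nhdsGT_iff_exists_Ioo_subset' h0).1 hU
  exact (inter_nonempty_of_mem_ae (leb_Ioo_pos hl).ne' hA).mono (inter_subset_inter_left _ hlU)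

/-- The side from which `t` is approached in a left limit, with the convention at `0`. -/
noncomputable def leftSide (t : Icc (0 : ℝ) T) : Filter (Icc (0 : ℝ) T) :=
  if 0 < (t : ℝ) then 𝓝[<] t else 𝓝[>] t

/-- The side from which `t` is approached in a right limit, with the convention at `T`. -/
noncomputable def rightSide (t : Icc (0 : ℝ) T) : Filter (Icc (0 : ℝ) T) :=
  if (t : ℝ) < T then 𝓝[>] t else 𝓝[<] t

lemma leftSide_le (t : Icc (0 : ℝ) T) : leftSide t ≤ 𝓝 t := by
  unfold leftSide; split_ifs <;> exact nhdsWithin_le_nhds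

lemma rightSide_le (t : Icc (0 : ℝ) T) : rightSide t ≤ 𝓝 t := by
  unfold rightSide; split_ifs <;> exact nhdsWithin_le_nhds

instance (t : Icc (0 : ℝ) T) : IsCountablyGenerated (leftSide t) := by
  unfold leftSide; split_ifs <;> infer_instance

instance (t : Icc (0 : ℝ) T) : IsCountablyGenerated (rightSide t) := by
  unfold rightSide; split_ifs <;> infer_instance

lemma neBot_leftSide_inf (hT : 0 < T) {A : Set (Icc (0 : ℝ) T)} (hA : A ∈ ae (leb T))
    (t : Icc (0 : ℝ) T) : NeBot (leftSide t ⊓ 𝓟 A) := by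
  unfold leftSide
  split_ifs with h
  · exact neBot_nhdsLT_inf hA h
  · exact neBot_nhdsGT_inf hA ((not_lt.1 h).trans_lt hT)

lemma neBot_rightSide_inf (hT : 0 < T) {A : Set (Icc (0 : ℝ) T)} (hA : A ∈ ae (leb T))
    (t : Icc (0 : ℝ) T) : NeBot (rightSide t ⊓ 𝓟 A) := by
  unfold rightSide
  split_ifs with h
  · exact neBot_nhdsGT_inf hA h
  · exact neBot_nhdsLT_inf hA (hT.trans_le (not_lt.1 h))

/-- Positivity of τ excludes the one bad case t = τ = 0, in which `leftSide` approaches from above.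
The condition τ < T plays this role in `eventually_lt_rightSide`. -/
lemma eventually_leftSide_lt {t : Icc (0 : ℝ) T} {τ : ℝ} (hτ : 0 < τ) (h : (t : ℝ) ≤ τ) :
    ∀ᶠ a : Icc (0 : ℝ) T in leftSide t, (a : ℝ) < τ := by
  rcases h.lt_or_eq with h | rfl
  · exact leftSide_le t ((continuous_subtype_val.tendsto t).eventually (gt_mem_nhds h))
  · rw [leftSide, if_pos hτ]
    exact eventually_mem_nhdsWithin

lemma eventually_lt_leftSide {t : Icc (0 : ℝ) T} {τ : ℝ} (h : τ < t) :
    ∀ᶠ a : Icc (0 : ℝ) T in leftSide t, τ < (a : ℝ) :=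
  leftSide_le t ((continuous_subtype_val.tendsto t).eventually (lt_mem_nhds h))

lemma eventually_lt_rightSide {t : Icc (0 : ℝ) T} {τ : ℝ} (hτ : τ < T) (h : τ ≤ t) :
    ∀ᶠ a : Icc (0 : ℝ) T in rightSide t, τ < (a : ℝ) := by
  rcases h.lt_or_eq with h | rfl
  · exact rightSide_le t ((continuous_subtype_val.tendsto t).eventually (lt_mem_nhds h))
  · rw [rightSide, if_pos hτ]
    exact eventually_mem_nhdsWithin

lemma eventually_rightSide_lt {t : Icc (0 : ℝ) T} {τ : ℝ} (h : (t : ℝ) < τ) :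
    ∀ᶠ a : Icc (0 : ℝ) T in rightSide t, (a : ℝ) < τ :=
  rightSide_le t ((continuous_subtype_val.tendsto t).eventually (gt_mem_nhds h))

/-- The intervals between points approaching `s` and `t` from outside converge to `[s,t]`. -/
lemma eventually_mem_Icc_iff (s t : Icc (0 : ℝ) T) {τ : ℝ} (hτ : τ ∈ Ioo 0 T) :
    ∀ᶠ q in leftSide s ×ˢ rightSide t, (τ ∈ Ioo (q.1 : ℝ) q.2 ↔ τ ∈ Icc (s : ℝ) t) ∧
      (τ ∈ Icc (q.1 : ℝ) q.2 ↔ τ ∈ Icc (s : ℝ) t) := by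
  have h1 : ∀ᶠ a : Icc (0 : ℝ) T in leftSide s,
      ((a : ℝ) < τ ↔ (s : ℝ) ≤ τ) ∧ ((a : ℝ) ≤ τ ↔ (s : ℝ) ≤ τ) := by
    rcases le_or_gt (s : ℝ) τ with h | h
    · filter_upwards [eventually_leftSide_lt hτ.1 h] with a ha
      exact ⟨iff_of_true ha h, iff_of_true ha.le h⟩
    · filter_upwards [eventually_lt_leftSide h] with a ha
      exact ⟨iff_of_false ha.not_gt h.not_ge, iff_of_false ha.not_ge h.not_ge⟩
  have h2 : ∀ᶠ b : Icc (0 : ℝ) T in rightSide t,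
      (τ < (b : ℝ) ↔ τ ≤ (t : ℝ)) ∧ (τ ≤ (b : ℝ) ↔ τ ≤ (t : ℝ)) := by
    rcases le_or_gt τ (t : ℝ) with h | h
    · filter_upwards [eventually_lt_rightSide hτ.2 h] with a ha
      exact ⟨iff_of_true ha h, iff_of_true ha.le h⟩
    · filter_upwards [eventually_rightSide_lt h] with a ha
      exact ⟨iff_of_false ha.not_gt h.not_ge, iff_of_false ha.not_ge h.not_ge⟩
  filter_upwards [h1.prod_mk h2] with q hq
  simp only [mem_Ioo, mem_Icc, hq.1.1, hq.1.2, hq.2.1, hq.2.2, and_self]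

lemma tendsto_setIntegral_of_ae_eventually_iff {α ι : Type*} [MeasurableSpace α] {μ : Measure α}
    {l : Filter ι} [IsCountablyGenerated l] {g : α → ℝ} (hg : Integrable g μ) {s : ι → Set α}
    {s' : Set α} (hs : ∀ i, MeasurableSet (s i)) (hs' : MeasurableSet s')
    (h : ∀ᵐ a ∂μ, ∀ᶠ i in l, (a ∈ s i ↔ a ∈ s')) :
    Tendsto (fun i => ∫ a in s i, g a ∂μ) l (𝓝 (∫ a in s', g a ∂μ)) := by
  simp_rw [← integral_indicator hs', ← integral_indicator (hs _)]
  refine tendsto_integral_filter_of_dominated_convergence (fun a => ‖g a‖)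
    (Eventually.of_forall fun i => (hg.indicator (hs i)).aestronglyMeasurable)
    (Eventually.of_forall fun i => ae_of_all _ fun a => norm_indicator_le_norm_self _ _)
    hg.norm ?_
  filter_upwards [h] with a ha
  refine tendsto_const_nhds.congr' ?_
  filter_upwards [ha] with i hi
  by_cases hmem : a ∈ s'
  · rw [indicator_of_mem hmem, indicator_of_mem (hi.2 hmem)]
  · rw [indicator_of_notMem hmem, indicator_of_notMem (mt hi.1 hmem)]

/-- The intervals (a,t) decrease to the empty set, so a possible atom of ν at t does no harm. -/
lemma eventually_measureReal_uIcc_lt_left (ν : Measure ℝ) [IsFiniteMeasure ν]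
    {t : Icc (0 : ℝ) T} (ht : 0 < (t : ℝ)) {c : ℝ} (hc : 0 < c) :
    ∀ᶠ a : Icc (0 : ℝ) T in 𝓝[<] t, ∀ᶠ b : Icc (0 : ℝ) T in 𝓝[<] t,
      ν.real (uIcc (a : ℝ) b) < c := by
  have h0 : (⟨0, le_rfl, t.2.1.trans t.2.2⟩ : Icc (0 : ℝ) T) < t := ht
  have hne : NeBot (𝓝[<] t) := nhdsLT_neBot_of_exists_lt ⟨_, h0⟩
  have hlim : Tendsto (fun a : Icc (0 : ℝ) T => ν.real (Ioo (a : ℝ) t)) (𝓝[<] t) (𝓝 0) := by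
    have := tendsto_measure_of_ae_tendsto_indicator_of_isFiniteMeasure (μ := ν) (𝓝[<] t)
      MeasurableSet.empty (As := fun a : Icc (0 : ℝ) T => Ioo (a : ℝ) t)
      (fun _ => measurableSet_Ioo) (ae_of_all _ fun τ => by
        rcases lt_or_ge τ (t : ℝ) with h | h
        · have : ∀ᶠ a : Icc (0 : ℝ) T in 𝓝[<] t, τ < a := nhdsWithin_le_nhds
            ((continuous_subtype_val.tendsto t).eventually (lt_mem_nhds h))
          filter_upwards [this] with a ha
          simp [ha.le]
        · exact Eventually.of_forall fun a => by simp [h])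
    simpa [measureReal_def, Function.comp_def] using (ENNReal.tendsto_toReal (by simp)).comp this
  obtain ⟨s, hs, hst⟩ := ((hlim.eventually (gt_mem_nhds hc)).and eventually_mem_nhdsWithin).exists
  filter_upwards [Ioo_mem_nhdsLT hst] with a ha
  filter_upwards [Ioo_mem_nhdsLT hst] with b hb
  have hsub : uIcc (a : ℝ) b ⊆ Ioo (s : ℝ) t := fun τ hτ =>
    ⟨lt_of_lt_of_le (lt_min ha.1 hb.1) hτ.1, lt_of_le_of_lt hτ.2 (max_lt ha.2 hb.2)⟩
  exact (measureReal_mono hsub).trans_lt hs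

lemma eventually_measureReal_uIcc_lt_right (ν : Measure ℝ) [IsFiniteMeasure ν]
    {t : Icc (0 : ℝ) T} (ht : (t : ℝ) < T) {c : ℝ} (hc : 0 < c) :
    ∀ᶠ a : Icc (0 : ℝ) T in 𝓝[>] t, ∀ᶠ b : Icc (0 : ℝ) T in 𝓝[>] t,
      ν.real (uIcc (a : ℝ) b) < c := by
  have h0 : t < (⟨T, t.2.1.trans t.2.2, le_rfl⟩ : Icc (0 : ℝ) T) := ht
  have hne : NeBot (𝓝[>] t) := nhdsGT_neBot_of_exists_gt ⟨_, h0⟩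
  have hlim : Tendsto (fun a : Icc (0 : ℝ) T => ν.real (Ioo (t : ℝ) a)) (𝓝[>] t) (𝓝 0) := by
    have := tendsto_measure_of_ae_tendsto_indicator_of_isFiniteMeasure (μ := ν) (𝓝[>] t)
      MeasurableSet.empty (As := fun a : Icc (0 : ℝ) T => Ioo (t : ℝ) a)
      (fun _ => measurableSet_Ioo) (ae_of_all _ fun τ => by
        rcases lt_or_ge (t : ℝ) τ with h | h
        · have : ∀ᶠ a : Icc (0 : ℝ) T in 𝓝[>] t, (a : ℝ) < τ := nhdsWithin_le_nhds
            ((continuous_subtype_val.tendsto t).eventually (gt_mem_nhds h))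
          filter_upwards [this] with a ha
          simp [ha.le]
        · exact Eventually.of_forall fun a => by simp [h])
    simpa [measureReal_def, Function.comp_def] using (ENNReal.tendsto_toReal (by simp)).comp this
  obtain ⟨s, hs, hst⟩ := ((hlim.eventually (gt_mem_nhds hc)).and eventually_mem_nhdsWithin).exists
  filter_upwards [Ioo_mem_nhdsGT hst] with a ha
  filter_upwards [Ioo_mem_nhdsGT hst] with b hb
  have hsub : uIcc (a : ℝ) b ⊆ Ioo (t : ℝ) s := fun τ hτ =>
    ⟨lt_of_lt_of_le (lt_min ha.1 hb.1) hτ.1, lt_of_le_of_lt hτ.2 (max_lt ha.2 hb.2)⟩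
  exact (measureReal_mono hsub).trans_lt hs

/-- This writes the distribution function in terms of intervals [0,t], whose masses the energy
balance determines. -/
lemma IsFinitePositiveOn.measure_Iic {ν : Measure ℝ} (h : IsFinitePositiveOn T ν) (hT : 0 < T)
    (a : ℝ) : ν (Iic a) = ν (Icc 0 (projIcc 0 T hT.le a : ℝ)) := by
  have hae : ∀ᵐ τ ∂ν, τ ∈ Ioo 0 T := h.null_compl
  refine measure_congr ?_
  filter_upwards [hae] with τ hτ
  refine propext ?_
  change τ ≤ a ↔ 0 ≤ τ ∧ τ ≤ max 0 (min T a)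
  simp [hτ.1.le, hτ.2.le, hτ.1.not_ge]

end OneSided

/-! ### Regulated representatives and the exact energy balance. -/

section Regulated

variable {d : ℕ} {T : ℝ} {p : ℝ≥0∞} {E : ℝ → Vec d → ℝ} {f : Vec d → Vec d}
  {w : PairSpace d p T} {ν : Measure ℝ} {M : ℝ} {A : Set (Icc (0 : ℝ) T)}

/-- A limit curve converges along any filter on which the dissipation is small. -/
lemma IsLimitCurve.exists_tendsto (hT : 0 < T) (hE : EnergyAssumptions T E)
    (h : IsLimitCurve E f w ν M A) {t : Icc (0 : ℝ) T} {F : Filter (Icc (0 : ℝ) T)} [NeBot F]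
    (hF : F ≤ 𝓝 t) (hA : A ∈ F)
    (hsmall : ∀ c > 0, ∀ᶠ a : Icc (0 : ℝ) T in F, ∀ᶠ b : Icc (0 : ℝ) T in F,
      ν.real (uIcc (a : ℝ) b) < c) :
    ∃ y, Tendsto w.1 F (𝓝 y) := by
  have hball : Metric.closedBall (0 : Vec d) M ∈ map w.1 F := by
    rw [mem_map]
    filter_upwards [hA] with a ha
    simpa using h.bound a ha
  -- Cluster values inherit criticality because the force is jointly continuous in time and
  -- position.
  have hcrit : ∀ y, MapClusterPt y F w.1 → gradE E t y = w.2 t := by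
    intro y hy
    by_contra hne
    have hcont : Continuous fun q : Icc (0 : ℝ) T × Vec d => gradE E q.1 q.2 - w.2 q.1 :=
      (hE.continuous_gradE hT).sub (w.2.continuous.comp continuous_fst)
    have hev := (hcont.tendsto (t, y)).eventually
      (isOpen_ne.mem_nhds (sub_ne_zero.2 hne : gradE E t y - w.2 t ≠ 0))
    rw [nhds_prod_eq] at hev
    obtain ⟨P, hP, Q, hQ, hPQ⟩ := eventually_prod_iff.1 hev
    obtain ⟨a, haQ, haP, haA⟩ :=
      ((hy.frequently hQ).and_eventually ((hP.filter_mono hF).and hA)).exists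
    exact hPQ haP haQ (sub_eq_zero.2 (h.crit a haA))
  obtain ⟨y, -, hy⟩ := (isCompact_closedBall (0 : Vec d) M).exists_clusterPt
    (f := map w.1 F) (le_principal_iff.2 hball)
  refine ⟨y, (isCompact_closedBall (0 : Vec d) M).le_nhds_of_unique_clusterPt hball
    fun y' _ hy' => ?_⟩
  by_contra hne
  obtain ⟨c, hc, δ, hδ, ρ, hρ, hcross⟩ := h.crossing t y y' (hcrit y hy) hne
  have hnear : ∀ᶠ a in F, dist a t < δ := hF (Metric.ball_mem_nhds t hδ)
  -- Two distinct cluster values give times a, b with values near each of them, so ν charges the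
  -- interval between by at least c, against `hsmall`. The time a is fixed before b is chosen.
  obtain ⟨a, hay, hasmall, had, haA⟩ := ((MapClusterPt.frequently hy
    (Metric.ball_mem_nhds y hρ)).and_eventually ((hsmall c hc).and (hnear.and hA))).exists
  obtain ⟨b, hby, hbsmall, hbd, hbA⟩ := ((MapClusterPt.frequently hy'
    (Metric.ball_mem_nhds y' hρ)).and_eventually (hasmall.and (hnear.and hA))).exists
  exact absurd (hcross a haA b hbA had hbd hay hby) (not_le.2 hbsmall)

/-- A limit curve has a regulated representative. -/
theorem IsLimitCurve.exists_isRegulatedRep (hT : 0 < T) (hE : EnergyAssumptions T E)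
    [IsFiniteMeasure ν] (h : IsLimitCurve E f w ν M A) :
    ∃ xt xm xp : Icc (0 : ℝ) T → Vec d, IsRegulatedRep w.1 xt xm xp := by
  classical
  have hl : ∀ t : Icc (0 : ℝ) T, ∃ y, 0 < (t : ℝ) → Tendsto w.1 (𝓝[<] t ⊓ 𝓟 A) (𝓝 y) := by
    intro t
    by_cases ht : 0 < (t : ℝ)
    · have := neBot_nhdsLT_inf h.mem_ae ht
      obtain ⟨y, hy⟩ := h.exists_tendsto hT hE (F := 𝓝[<] t ⊓ 𝓟 A)
        (inf_le_left.trans nhdsWithin_le_nhds) (mem_inf_of_right (mem_principal_self A))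
        fun c hc => ((eventually_measureReal_uIcc_lt_left ν ht hc).filter_mono inf_le_left).mono
          fun a ha => ha.filter_mono inf_le_left
      exact ⟨y, fun _ => hy⟩
    · exact ⟨0, fun h => absurd h ht⟩
  have hr : ∀ t : Icc (0 : ℝ) T, ∃ y, (t : ℝ) < T → Tendsto w.1 (𝓝[>] t ⊓ 𝓟 A) (𝓝 y) := by
    intro t
    by_cases ht : (t : ℝ) < T
    · have := neBot_nhdsGT_inf h.mem_ae ht
      obtain ⟨y, hy⟩ := h.exists_tendsto hT hE (F := 𝓝[>] t ⊓ 𝓟 A)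
        (inf_le_left.trans nhdsWithin_le_nhds) (mem_inf_of_right (mem_principal_self A))
        fun c hc => ((eventually_measureReal_uIcc_lt_right ν ht hc).filter_mono inf_le_left).mono
          fun a ha => ha.filter_mono inf_le_left
      exact ⟨y, fun _ => hy⟩
    · exact ⟨0, fun h => absurd h ht⟩
  choose l hl using hl
  choose r hr using hr
  -- Left limits stay in closed sets that contain the nearby values on A. This upgrades limits along
  -- A to limits along all times.
  have hmem : ∀ (s : Icc (0 : ℝ) T) (V : Set (Vec d)), IsClosed V → 0 < (s : ℝ) →
      ∀ a < s, (∀ b ∈ Ioo a s, b ∈ A → w.1 b ∈ V) → l s ∈ V := by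
    intro s V hV hs a ha hb
    have := neBot_nhdsLT_inf h.mem_ae hs
    refine hV.mem_of_tendsto (hl s hs) ?_
    rw [eventually_inf_principal]
    filter_upwards [Ioo_mem_nhdsLT ha] with b hb' hbA using hb b hb' hbA
  -- Off A the left limit is used, also when proving right limits. Its value at 0 is arbitrary, but
  -- no one-sided limit ever evaluates there.
  refine ⟨fun τ => if τ ∈ A then w.1 τ else l τ, fun t => if 0 < (t : ℝ) then l t else r t,
    fun t => if (t : ℝ) < T then r t else l t, ?_, fun t ht => ?_, fun t ht => ?_,
    fun t ht => ?_, fun t ht => ?_⟩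
  · filter_upwards [h.mem_ae] with τ hτ
    rw [if_pos hτ]
  · rw [if_pos ht, (closed_nhds_basis (l t)).tendsto_right_iff]
    rintro V ⟨hV, hVc⟩
    have h0 : (⟨0, le_rfl, t.2.1.trans t.2.2⟩ : Icc (0 : ℝ) T) < t := ht
    obtain ⟨a, ha, haV⟩ := (mem_nhdsLT_iff_exists_Ioo_subset' h0).1
      (eventually_inf_principal.1 ((hl t ht).eventually hV))
    filter_upwards [Ioo_mem_nhdsLT ha] with s hs
    split_ifs with hsA
    · exact haV hs hsA
    · exact hmem s V hVc (a.2.1.trans_lt hs.1) a hs.1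
        fun b hb hbA => haV ⟨hb.1, hb.2.trans hs.2⟩ hbA
  · rw [if_pos ht, (closed_nhds_basis (r t)).tendsto_right_iff]
    rintro V ⟨hV, hVc⟩
    have h0 : t < (⟨T, t.2.1.trans t.2.2, le_rfl⟩ : Icc (0 : ℝ) T) := ht
    obtain ⟨a, ha, haV⟩ := (mem_nhdsGT_iff_exists_Ioo_subset' h0).1
      (eventually_inf_principal.1 ((hr t ht).eventually hV))
    filter_upwards [Ioo_mem_nhdsGT ha] with s hs
    split_ifs with hsA
    · exact haV hs hsA
    · exact hmem s V hVc (t.2.1.trans_lt hs.1) t hs.1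
        fun b hb hbA => haV ⟨hb.1, hb.2.trans hs.2⟩ hbA
  · rw [if_neg (by rw [ht]; exact lt_irrefl _), if_pos (by rw [ht]; exact hT)]
  · rw [if_neg (by rw [ht]; exact lt_irrefl _), if_pos (by rw [ht]; exact hT)]

lemma IsRegulatedRep.tendsto_leftSide (hT : 0 < T) {x : LpCurve d p T}
    {xt xm xp : Icc (0 : ℝ) T → Vec d} (h : IsRegulatedRep x xt xm xp) (t : Icc (0 : ℝ) T) :
    Tendsto xt (leftSide t) (𝓝 (xm t)) := by
  unfold leftSide
  split_ifs with ht
  · exact h.left_lim t ht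
  · have ht0 : (t : ℝ) = 0 := le_antisymm (not_lt.1 ht) t.2.1
    rw [h.left_zero t ht0]
    exact h.right_lim t (by rw [ht0]; exact hT)

lemma IsRegulatedRep.tendsto_rightSide (hT : 0 < T) {x : LpCurve d p T}
    {xt xm xp : Icc (0 : ℝ) T → Vec d} (h : IsRegulatedRep x xt xm xp) (t : Icc (0 : ℝ) T) :
    Tendsto xt (rightSide t) (𝓝 (xp t)) := by
  unfold rightSide
  split_ifs with ht
  · exact h.right_lim t ht
  · have ht0 : (t : ℝ) = T := le_antisymm t.2.2 (not_lt.1 ht)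
    rw [h.right_top t ht0]
    exact h.left_lim t (by rw [ht0]; exact hT)

/-- The energy balance of a limit curve. -/
theorem IsLimitCurve.energy_balance [Fact (1 ≤ p)] (hT : 0 < T) (hE : EnergyAssumptions T E)
    (hf : ControlAssumptions f) (h : IsLimitCurve E f w ν M A) (hν : IsFinitePositiveOn T ν)
    {xt xm xp : Icc (0 : ℝ) T → Vec d} (hreg : IsRegulatedRep w.1 xt xm xp)
    {s t : Icc (0 : ℝ) T} (hst : s ≤ t) :
    Ebar E t (xp t) (w.2 t) + ν.real (Icc s t)
      = Ebar E s (xm s) (w.2 s) + ∫ τ in Icc s t, power E f w τ ∂(leb T) := by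
  have := hν.finite
  -- At s = t = 0 or s = t = T both filters approach from the same side, so their points need not be
  -- ordered. There xp = xm and ν has no mass, so the balance is trivial.
  by_cases hdeg : s = t ∧ (s : ℝ) ∉ Ioo 0 T
  · obtain ⟨rfl, hs⟩ := hdeg
    have hx : xp s = xm s := by
      rw [mem_Ioo, not_and_or, not_lt, not_lt] at hs
      rcases hs with hs | hs
      · exact (hreg.left_zero s (le_antisymm hs s.2.1)).symm
      · exact hreg.right_top s (le_antisymm s.2.2 hs)
    have hν0 : ν.real (Icc (s : ℝ) s) = 0 := by
      rw [Icc_self, measureReal_def, measure_mono_null (singleton_subset_iff.2 hs) hν.null_compl]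
      rfl
    rw [hx, hν0, Icc_self, Measure.restrict_eq_zero.2 (leb_singleton s), integral_zero_measure]
  -- Intersecting with the times where class and representative agree lets the bounds on `w.1` be
  -- passed to the one-sided limits of `xt`.
  set A' : Set (Icc (0 : ℝ) T) := A ∩ {τ | w.1 τ = xt τ} with hA'
  have h' : IsLimitCurve E f w ν M A' := h.mono (inter_mem h.mem_ae hreg.ae_eq) inter_subset_left
  set G := leftSide s ⊓ 𝓟 A' with hG
  set H := rightSide t ⊓ 𝓟 A' with hH
  have hGne : NeBot G := neBot_leftSide_inf hT h'.mem_ae s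
  have hHne : NeBot H := neBot_rightSide_inf hT h'.mem_ae t
  have hGA : ∀ᶠ a in G, a ∈ A' := mem_inf_of_right (mem_principal_self _)
  have hHA : ∀ᶠ b in H, b ∈ A' := mem_inf_of_right (mem_principal_self _)
  have hGs : G ≤ 𝓝 s := inf_le_left.trans (leftSide_le s)
  have hHt : H ≤ 𝓝 t := inf_le_left.trans (rightSide_le t)
  have hle : G ×ˢ H ≤ leftSide s ×ˢ rightSide t := prod_mono inf_le_left inf_le_left
  have hxG : Tendsto w.1 G (𝓝 (xm s)) :=
    ((hreg.tendsto_leftSide hT s).mono_left inf_le_left).congr' (hGA.mono fun a ha => ha.2.symm)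
  have hxH : Tendsto w.1 H (𝓝 (xp t)) :=
    ((hreg.tendsto_rightSide hT t).mono_left inf_le_left).congr' (hHA.mono fun a ha => ha.2.symm)
  have hEb : ∀ {F : Filter (Icc (0 : ℝ) T)} {c : Icc (0 : ℝ) T} {y : Vec d}, F ≤ 𝓝 c →
      Tendsto w.1 F (𝓝 y) →
      Tendsto (fun a : Icc (0 : ℝ) T => Ebar E a (w.1 a) (w.2 a)) F (𝓝 (Ebar E c y (w.2 c))) :=
    fun {F c y} hF hy => (hE.continuous_Ebar.tendsto (c, y, w.2 c)).comp
      ((tendsto_id'.2 hF).prodMk_nhds (hy.prodMk_nhds ((w.2.continuous.tendsto c).mono_left hF)))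
  have hlt : ∀ᶠ q in G ×ˢ H, q.1 ≤ q.2 := by
    rcases hst.lt_or_eq with hlt | heq
    · exact ((tendsto_fst.mono_right hGs).eventually_lt (tendsto_snd.mono_right hHt) hlt).mono
        fun q hq => hq.le
    · have hs : (s : ℝ) ∈ Ioo 0 T := not_not.1 fun hcon => hdeg ⟨heq, hcon⟩
      have h1 : ∀ᶠ a : Icc (0 : ℝ) T in G, (a : ℝ) < s :=
        (eventually_leftSide_lt hs.1 le_rfl).filter_mono inf_le_left
      have h2 : ∀ᶠ b : Icc (0 : ℝ) T in H, (s : ℝ) < b :=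
        (eventually_lt_rightSide hs.2 (by rw [heq])).filter_mono inf_le_left
      filter_upwards [h1.prod_mk h2] with q hq
      exact (hq.1.trans hq.2 : (q.1 : ℝ) < q.2).le
  have hνae : ∀ᵐ τ ∂ν, τ ∈ Ioo 0 T := hν.null_compl
  -- Open and closed intervals between points approaching from outside have the same limit [s,t], so
  -- the lower and the upper bound coincide in the limit.
  have hlow : Tendsto (fun q : Icc (0 : ℝ) T × Icc (0 : ℝ) T => ν.real (Ioo (q.1 : ℝ) q.2))
      (G ×ˢ H) (𝓝 (ν.real (Icc (s : ℝ) t))) :=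
    (ENNReal.tendsto_toReal (measure_ne_top _ _)).comp
      (tendsto_measure_of_ae_tendsto_indicator_of_isFiniteMeasure (G ×ˢ H) measurableSet_Icc
        (fun _ => measurableSet_Ioo) (hνae.mono fun τ hτ =>
          ((eventually_mem_Icc_iff s t hτ).filter_mono hle).mono fun q hq => hq.1))
  have hupp : Tendsto (fun q : Icc (0 : ℝ) T × Icc (0 : ℝ) T => ν.real (Icc (q.1 : ℝ) q.2))
      (G ×ˢ H) (𝓝 (ν.real (Icc (s : ℝ) t))) :=
    (ENNReal.tendsto_toReal (measure_ne_top _ _)).comp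
      (tendsto_measure_of_ae_tendsto_indicator_of_isFiniteMeasure (G ×ˢ H) measurableSet_Icc
        (fun _ => measurableSet_Icc) (hνae.mono fun τ hτ =>
          ((eventually_mem_Icc_iff s t hτ).filter_mono hle).mono fun q hq => hq.2))
  have hpow : Tendsto (fun q : Icc (0 : ℝ) T × Icc (0 : ℝ) T =>
      ∫ τ in Icc q.1 q.2, power E f w τ ∂(leb T)) (G ×ˢ H)
      (𝓝 (∫ τ in Icc s t, power E f w τ ∂(leb T))) :=
    tendsto_setIntegral_of_ae_eventually_iff
      (h.curveBound.integrable (hE.continuous_powerFun hT hf)) (fun _ => measurableSet_Icc)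
      measurableSet_Icc ((ae_mem_Ioo_leb T).mono fun τ hτ =>
        ((eventually_mem_Icc_iff s t hτ).filter_mono hle).mono fun q hq => hq.2)
  have hmid := (((hEb hGs hxG).comp tendsto_fst).sub ((hEb hHt hxH).comp tendsto_snd)).add hpow
  have hAA := hGA.prod_mk hHA
  have hge := le_of_tendsto_of_tendsto hlow hmid (by
    filter_upwards [hlt, hAA] with q hq hqA using h'.lower q.1 hqA.1 q.2 hqA.2 hq)
  have hle' := le_of_tendsto_of_tendsto hmid hupp (by
    filter_upwards [hlt, hAA] with q hq hqA using h'.upper q.1 hqA.1 q.2 hqA.2 hq)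
  linarith

end Regulated

/-! ### Uniqueness of the dissipation measure. -/

section Uniqueness

variable {d : ℕ} {T : ℝ} {p : ℝ≥0∞} [Fact (1 ≤ p)] {E : ℝ → Vec d → ℝ} {f : Vec d → Vec d}
  {w : PairSpace d p T} {ν ν' : Measure ℝ} {hT : 0 < T}

lemma IsDissipationMeasure.energy_balance (hE : EnergyAssumptions T E)
    (hf : ControlAssumptions f) (h : IsDissipationMeasure hT E f p w ν)
    {xt xm xp : Icc (0 : ℝ) T → Vec d} (hreg : IsRegulatedRep w.1 xt xm xp)
    {s t : Icc (0 : ℝ) T} (hst : s ≤ t) :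
    Ebar E t (xp t) (w.2 t) + ν.real (Icc s t)
      = Ebar E s (xm s) (w.2 s) + ∫ τ in Icc s t, power E f w τ ∂(leb T) := by
  obtain ⟨M, A, hA⟩ := h.exists_isLimitCurve hE hf
  exact hA.energy_balance hT hE hf h.1 hreg hst

lemma IsDissipationMeasure.exists_isRegulatedRep (hE : EnergyAssumptions T E)
    (hf : ControlAssumptions f) (h : IsDissipationMeasure hT E f p w ν) :
    ∃ xt xm xp : Icc (0 : ℝ) T → Vec d, IsRegulatedRep w.1 xt xm xp := by
  obtain ⟨M, A, hA⟩ := h.exists_isLimitCurve hE hf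
  have := h.1.finite
  exact hA.exists_isRegulatedRep hT hE

/-- One representative serves for both measures. The balance on [0,t] then expresses each mass by
the same energies and power, so the distribution functions agree. -/
theorem IsDissipationMeasure.unique (hE : EnergyAssumptions T E)
    (hf : ControlAssumptions f) (h : IsDissipationMeasure hT E f p w ν)
    (h' : IsDissipationMeasure hT E f p w ν') : ν = ν' := by
  obtain ⟨xt, xm, xp, hreg⟩ := h.exists_isRegulatedRep hE hf
  have := h.1.finite
  have := h'.1.finite
  refine Measure.ext_of_Iic _ _ fun a => ?_
  rw [h.1.measure_Iic hT, h'.1.measure_Iic hT]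
  set t := projIcc 0 T hT.le a
  have hst : (⟨0, left_mem_Icc.2 hT.le⟩ : Icc (0 : ℝ) T) ≤ t := t.2.1
  have e1 := h.energy_balance hE hf hreg hst
  have e2 := h'.energy_balance hE hf hreg hst
  have : ν.real (Icc 0 (t : ℝ)) = ν'.real (Icc 0 (t : ℝ)) := by
    dsimp only at e1 e2; linarith
  exact (measureReal_eq_measureReal_iff).1 this

end Uniqueness

/-! ### Curves in the support of Π* as limits of solutions. -/

section Support

variable {d : ℕ} {T : ℝ} {p : ℝ≥0∞} [Fact (1 ≤ p)] {E : ℝ → Vec d → ℝ} {f : Vec d → Vec d}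
  {η₀ : Measure (Vec d × Vec d)} {P : Measure (PathSpace d p T)} {hT : 0 < T}

lemma isProbabilityMeasure_pairMarginal [IsProbabilityMeasure P] :
    IsProbabilityMeasure (pairMarginal P) :=
  Measure.isProbabilityMeasure_map measurable_snd.snd.aemeasurable

/-- Points of the support of the limit law are approximated by trajectories of the flow. -/
lemma exists_flow_near_of_mem_support [IsProbabilityMeasure P]
    {K : Set (Vec d × Vec d)} (hK : η₀ Kᶜ = 0) (hP : IsNarrowLimitPoint hT E f p η₀ P)
    {w : PairSpace d p T} (hw : w ∈ (pairMarginal P).support) {r : ℝ} (hr : 0 < r) :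
    ∃ ε z, 0 < ε ∧ ε < r ∧ z ∈ K ∧
      dist ((toLpCurve p (flow hT E f ε z).1, (flow hT E f ε z).2) : PairSpace d p T) w < r := by
  obtain ⟨ε, hε, hconv⟩ := hP
  -- A hat function of the pair component, positive exactly on the open ball of radius r around w.
  set φ : PathSpace d p T →ᵇ ℝ := BoundedContinuousFunction.ofNormedAddCommGroup
    (fun ω => max 0 (1 - dist ω.2.2 w / r)) (by fun_prop) 1 (fun ω => by
      have : 0 ≤ dist ω.2.2 w / r := by positivity
      rw [Real.norm_of_nonneg (le_max_left _ _)]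
      exact max_le zero_le_one (by linarith)) with hφ
  have hφ0 : ∀ ω, 0 ≤ φ ω := fun ω => le_max_left _ _
  have hφpos : ∀ ω, 0 < φ ω ↔ dist ω.2.2 w < r := fun ω => by
    change 0 < max 0 (1 - dist ω.2.2 w / r) ↔ _
    rw [lt_max_iff, or_iff_right (lt_irrefl _), sub_pos, div_lt_one hr]
  have hg : Measurable fun w' : PairSpace d p T => max 0 (1 - dist w' w / r) :=
    Continuous.measurable (by fun_prop)
  have hφm : Measurable φ := hg.comp measurable_snd.snd
  have hpos : 0 < ∫ ω, φ ω ∂P := by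
    rw [integral_pos_iff_support_of_nonneg hφ0
      (Integrable.of_bound hφm.aestronglyMeasurable ‖φ‖ (ae_of_all _ φ.norm_coe_le_norm))]
    have hball := (Measure.mem_support_iff_forall w).1 hw _ (Metric.ball_mem_nhds w hr)
    rw [pairMarginal, Measure.map_apply measurable_snd.snd measurableSet_ball] at hball
    refine hball.trans_le (measure_mono fun ω hω => ?_)
    exact ((hφpos ω).2 hω).ne'
  obtain ⟨n, hn, hnr⟩ := (((hconv φ).eventually (lt_mem_nhds hpos)).and
    (hε.2.eventually (gt_mem_nhds hr))).exists
  refine ⟨ε n, ?_⟩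
  by_contra! hcon
  refine absurd hn (not_lt.2 ?_)
  -- If the trajectory map is not measurable, the pushforward is the zero measure by convention and
  -- the integral again fails to be positive. Measurability of the flow is thus never needed.
  by_cases hmeas : AEMeasurable (fun z : Vec d × Vec d =>
      ((z.1, z.2, toLpCurve p (flow hT E f (ε n) z).1, (flow hT E f (ε n) z).2) :
        PathSpace d p T)) η₀
  · rw [pathLaw, integral_map hmeas hφm.aestronglyMeasurable]
    refine integral_nonpos_of_ae ?_
    have hKae : ∀ᵐ z ∂η₀, z ∈ K := hK
    filter_upwards [hKae] with z hz
    exact not_lt.1 fun h => absurd ((hφpos _).1 h) (not_lt.2 (hcon z (hε.1 n) hnr hz))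
  · rw [pathLaw, Measure.map_of_not_aemeasurable hmeas, integral_zero_measure]

/-- Points of the support of the limit law are limits of solutions. -/
lemma exists_solutions_tendsto_of_mem_support (hE : EnergyAssumptions T E)
    (hf : ControlAssumptions f) [IsProbabilityMeasure P]
    {K : Set (Vec d × Vec d)} (hKc : IsCompact K) (hK : η₀ Kᶜ = 0)
    (hP : IsNarrowLimitPoint hT E f p η₀ P)
    {w : PairSpace d p T} (hw : w ∈ (pairMarginal P).support) :
    ∃ (ε : ℕ → ℝ) (z : ℕ → Vec d × Vec d) (z₀ : Vec d × Vec d) (x u : ℕ → ContCurve d T),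
      IsVanishing ε ∧ Tendsto z atTop (𝓝 z₀) ∧ (∀ n, z n ∈ K) ∧
      (∀ n, IsSolution hT E f (ε n) (z n) (x n) (u n)) ∧
      Tendsto (fun n => ((toLpCurve p (x n), u n) : PairSpace d p T)) atTop (𝓝 w) := by
  have hpos : ∀ n : ℕ, (0 : ℝ) < 1 / ((n : ℝ) + 1) := fun n => by positivity
  choose ε z hε0 hεr hzK hdist using fun n : ℕ =>
    exists_flow_near_of_mem_support hK hP hw (hpos n)
  have hlim0 := tendsto_one_div_add_atTop_nhds_zero_nat (𝕜 := ℝ)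
  have hε : Tendsto ε atTop (𝓝 0) :=
    squeeze_zero (fun n => (hε0 n).le) (fun n => (hεr n).le) hlim0
  have hx : Tendsto (fun n => ((toLpCurve p (flow hT E f (ε n) (z n)).1,
      (flow hT E f (ε n) (z n)).2) : PairSpace d p T)) atTop (𝓝 w) := by
    rw [tendsto_iff_dist_tendsto_zero]
    exact squeeze_zero (fun n => dist_nonneg) (fun n => (hdist n).le) hlim0
  obtain ⟨z₀, -, φ, hφ, hz⟩ := hKc.tendsto_subseq hzK
  exact ⟨ε ∘ φ, z ∘ φ, z₀, fun n => (flow hT E f (ε (φ n)) (z (φ n))).1,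
    fun n => (flow hT E f (ε (φ n)) (z (φ n))).2, ⟨fun n => hε0 _, hε.comp hφ.tendsto_atTop⟩,
    hz, fun n => hzK _, fun n => flow_isSolution hT hE hf (hε0 _) _, hx.comp hφ.tendsto_atTop⟩

/-- One `M` serves the whole support because all approximating solutions start in the same compact
set. -/
lemma exists_curveBound_support (hE : EnergyAssumptions T E)
    (hf : ControlAssumptions f) [IsProbabilityMeasure P]
    {K : Set (Vec d × Vec d)} (hKc : IsCompact K) (hK : η₀ Kᶜ = 0)
    (hP : IsNarrowLimitPoint hT E f p η₀ P) :
    ∃ M, ∀ w ∈ (pairMarginal P).support, CurveBound M w := by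
  obtain ⟨R, hR⟩ := hKc.isBounded.exists_norm_le
  obtain ⟨M, -, hM⟩ := exists_bound_isSolution hT hE hf R
  refine ⟨M, fun w hw => ?_⟩
  obtain ⟨ε, z, z₀, x, u, hε, -, hzK, hsol, hlim⟩ :=
    exists_solutions_tendsto_of_mem_support hE hf hKc hK hP hw
  exact CurveBound.of_tendsto hlim (Eventually.of_forall fun n =>
    curveBound_toLpCurve (hM _ _ _ _ (hε.1 n) (hR _ (hzK n)) (hsol n)))

/-- Points of the support of the limit law have a dissipation measure. -/
theorem exists_isDissipationMeasure_of_mem_support (hE : EnergyAssumptions T E)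
    (hf : ControlAssumptions f) [IsProbabilityMeasure P]
    {K : Set (Vec d × Vec d)} (hKc : IsCompact K) (hK : η₀ Kᶜ = 0)
    (hP : IsNarrowLimitPoint hT E f p η₀ P)
    {w : PairSpace d p T} (hw : w ∈ (pairMarginal P).support) :
    ∃ ν, IsDissipationMeasure hT E f p w ν := by
  obtain ⟨R, hR⟩ := hKc.isBounded.exists_norm_le
  obtain ⟨M, -, hM⟩ := exists_bound_isSolution hT hE hf R
  obtain ⟨B, hB⟩ := exists_bound_dissipation hT hE hf M
  obtain ⟨ε, z, z₀, x, u, hε, hz, hzK, hsol, hlim⟩ :=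
    exists_solutions_tendsto_of_mem_support hE hf hKc hK hP hw
  have hnull : ∀ n, dissipation hT E (ε n) (x n) (u n) (Ioo 0 T)ᶜ = 0 := fun n =>
    withDensity_absolutelyContinuous _ _ (by
      rw [Measure.restrict_apply measurableSet_Ioo.compl]; simp)
  obtain ⟨ν, hν, φ, hφ, hφν⟩ := exists_subseq_weakStarTendsto (T := T)
    (fun n => dissipation hT E (ε n) (x n) (u n)) hnull B.toNNReal fun n => by
      have := (hsol n).isFiniteMeasure_dissipation hE (hε.1 n)
      have huniv : dissipation hT E (ε n) (x n) (u n) univ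
          = dissipation hT E (ε n) (x n) (u n) (Icc 0 T) := by
        refine measure_congr ?_
        have hae : ∀ᵐ t ∂(dissipation hT E (ε n) (x n) (u n)), t ∈ Ioo 0 T := hnull n
        filter_upwards [hae] with t ht
        exact propext (iff_of_true trivial (Ioo_subset_Icc_self ht))
      rw [huniv, ← ofReal_measureReal]
      exact ENNReal.ofReal_le_ofReal (hB _ _ _ _ (hε.1 n) (hsol n)
        (hM _ _ _ _ (hε.1 n) (hR _ (hzK n)) (hsol n)))
  have hφt := hφ.tendsto_atTop
  exact ⟨ν, hν, ε ∘ φ, z ∘ φ, z₀, x ∘ φ, u ∘ φ, ⟨fun n => hε.1 _, hε.2.comp hφt⟩,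
    hz.comp hφt, fun n => hsol _, hlim.comp hφt, hφν⟩

end Support

/-! ### Measurability of one-sided limits in the curve. -/

section Measurability

variable {d : ℕ} {T : ℝ} {p : ℝ≥0∞} [Fact (1 ≤ p)]

lemma ContinuousOn.measurable_indicator {α : Type*} [TopologicalSpace α] [MeasurableSpace α]
    [OpensMeasurableSpace α] {g : α → ℝ} {S : Set α} (hg : ContinuousOn g S)
    (hS : MeasurableSet S) : Measurable (S.indicator g) := by
  classical
  have h := ContinuousOn.measurable_piecewise (g := fun _ : α => (0 : ℝ)) hg continuousOn_const hS
  exact (piecewise_eq_indicator (s := S) (f := g)) ▸ h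

/-- Essential one-sided limits of functionals of curves are measurable. -/
lemma measurable_indicator_essential_limit {l : Filter (Icc (0 : ℝ) T)} [IsCountablyGenerated l]
    [l.IsMeasurablyGenerated] (hl : ∀ U ∈ l, leb T U ≠ 0)
    {Φ : Icc (0 : ℝ) T × Vec d × Vec d → ℝ} (hΦ : Continuous Φ) {M : ℝ}
    {S : Set (PairSpace d p T)} (hSm : MeasurableSet S) (hS : ∀ w ∈ S, CurveBound M w)
    {y : PairSpace d p T → ℝ}
    (hy : ∀ w ∈ S, Tendsto (fun τ => Φ (τ, w.1 τ, w.2 τ)) (l ⊓ ae (leb T)) (𝓝 (y w))) :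
    Measurable (S.indicator y) := by
  obtain ⟨U, hU⟩ := l.exists_antitone_basis
  refine measurable_of_tendsto_metrizable (f := fun n => S.indicator fun w : PairSpace d p T =>
      ((leb T).real (U n))⁻¹ * ∫ τ in U n, Φ (τ, w.1 τ, w.2 τ) ∂(leb T))
    (fun n => ContinuousOn.measurable_indicator
      (continuousOn_const.mul (continuousOn_integral_comp_curve hΦ hS (U n))) hSm) ?_
  rw [tendsto_pi_nhds]
  intro w
  by_cases hw : w ∈ S
  · simp only [indicator_of_mem hw]
    have hint := (hS w hw).integrable hΦ
    -- Averages over sets shrinking along `l` converge to the essential limit: the integral differs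
    -- from measure times limit by a small o of the measure.
    have ho := (hy w hw).integral_sub_linear_isLittleO_ae
      hint.aestronglyMeasurable.stronglyMeasurableAtFilter
      (Measure.finiteAtFilter_of_finite (leb T) l) hU.tendsto_smallSets
    have h0 := ho.tendsto_div_nhds_zero
    have h1 := h0.add_const (y w)
    rw [zero_add] at h1
    refine h1.congr fun n => ?_
    have hne : (leb T).real (U n) ≠ 0 :=
      (measureReal_ne_zero_iff).2 (hl _ (hU.mem n))
    simp only [smul_eq_mul]
    field_simp
    ring
  · simp only [indicator_of_notMem hw]
    exact tendsto_const_nhds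

instance (t : Icc (0 : ℝ) T) : (leftSide t).IsMeasurablyGenerated := by
  unfold leftSide; split_ifs <;> infer_instance

instance (t : Icc (0 : ℝ) T) : (rightSide t).IsMeasurablyGenerated := by
  unfold rightSide; split_ifs <;> infer_instance

lemma leb_ne_zero_of_neBot {l : Filter (Icc (0 : ℝ) T)}
    (h : ∀ A ∈ ae (leb T), NeBot (l ⊓ 𝓟 A)) : ∀ U ∈ l, leb T U ≠ 0 := by
  intro U hU h0
  have hne := h Uᶜ (compl_mem_ae_iff.2 h0)
  obtain ⟨τ, hτ, hτ'⟩ := inf_principal_neBot_iff.1 hne U hU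
  exact hτ' hτ

omit [Fact (1 ≤ p)] in
-- A class in L^p is known only almost everywhere, so the limit is taken along `l ⊓ ae`. One-sided
-- energies therefore depend on the class and not on the representative.
lemma IsRegulatedRep.tendsto_Ebar {E : ℝ → Vec d → ℝ} (hE : EnergyAssumptions T E)
    {w : PairSpace d p T} {xt : Icc (0 : ℝ) T → Vec d}
    (hae : (w.1 : Icc (0 : ℝ) T → Vec d) =ᵐ[leb T] xt) {l : Filter (Icc (0 : ℝ) T)}
    {t : Icc (0 : ℝ) T} (hl : l ≤ 𝓝 t) {y : Vec d} (hy : Tendsto xt l (𝓝 y)) :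
    Tendsto (fun τ : Icc (0 : ℝ) T => Ebar E τ (w.1 τ) (w.2 τ)) (l ⊓ ae (leb T))
      (𝓝 (Ebar E t y (w.2 t))) := by
  have h1 : Tendsto w.1 (l ⊓ ae (leb T)) (𝓝 y) := by
    refine (hy.mono_left inf_le_left).congr' ?_
    exact (hae.filter_mono inf_le_right).mono fun τ hτ => hτ.symm
  have hl' : l ⊓ ae (leb T) ≤ 𝓝 t := inf_le_left.trans hl
  exact (hE.continuous_Ebar.tendsto (t, y, w.2 t)).comp ((tendsto_id'.2 hl').prodMk_nhds
    (h1.prodMk_nhds ((w.2.continuous.tendsto t).mono_left hl')))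

lemma integrable_of_measurable_indicator {α : Type*} [MeasurableSpace α] {μ : Measure α}
    [IsFiniteMeasure μ] {S : Set α} (hS : S ∈ ae μ) {g : α → ℝ} (hg : Measurable (S.indicator g))
    {B : ℝ} (hB : ∀ w ∈ S, |g w| ≤ B) : Integrable g μ := by
  have hae : S.indicator g =ᵐ[μ] g := by
    filter_upwards [hS] with w hw
    rw [indicator_of_mem hw]
  refine Integrable.of_bound (hg.aestronglyMeasurable.congr hae) B ?_
  filter_upwards [hS] with w hw using hB w hw

end Measurability

/-! ### The mixture of dissipation measures and its balance. -/

section MeanField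

variable {d : ℕ} {T : ℝ} {p : ℝ≥0∞} [Fact (1 ≤ p)] {E : ℝ → Vec d → ℝ} {f : Vec d → Vec d}
  {hT : 0 < T} {S : Set (PairSpace d p T)} {M : ℝ}
  {xt xm xp : PairSpace d p T → Icc (0 : ℝ) T → Vec d} {ν : PairSpace d p T → Measure ℝ}

lemma measurable_indicator_Ebar_left (hT : 0 < T) (hE : EnergyAssumptions T E)
    (hSm : MeasurableSet S) (hS : ∀ w ∈ S, CurveBound M w)
    (hreg : ∀ w ∈ S, IsRegulatedRep w.1 (xt w) (xm w) (xp w)) (t : Icc (0 : ℝ) T) :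
    Measurable (S.indicator fun w => Ebar E t (xm w t) (w.2 t)) :=
  measurable_indicator_essential_limit (l := leftSide t)
    (leb_ne_zero_of_neBot fun _ hA => neBot_leftSide_inf hT hA t) hE.continuous_Ebar hSm hS
    fun w hw => IsRegulatedRep.tendsto_Ebar hE (hreg w hw).ae_eq (leftSide_le t)
      ((hreg w hw).tendsto_leftSide hT t)

lemma measurable_indicator_Ebar_right (hT : 0 < T) (hE : EnergyAssumptions T E)
    (hSm : MeasurableSet S) (hS : ∀ w ∈ S, CurveBound M w)
    (hreg : ∀ w ∈ S, IsRegulatedRep w.1 (xt w) (xm w) (xp w)) (t : Icc (0 : ℝ) T) :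
    Measurable (S.indicator fun w => Ebar E t (xp w t) (w.2 t)) :=
  measurable_indicator_essential_limit (l := rightSide t)
    (leb_ne_zero_of_neBot fun _ hA => neBot_rightSide_inf hT hA t) hE.continuous_Ebar hSm hS
    fun w hw => IsRegulatedRep.tendsto_Ebar hE (hreg w hw).ae_eq (rightSide_le t)
      ((hreg w hw).tendsto_rightSide hT t)

lemma measurable_indicator_power (hT : 0 < T) (hE : EnergyAssumptions T E)
    (hf : ControlAssumptions f) (hSm : MeasurableSet S) (hS : ∀ w ∈ S, CurveBound M w)
    (I : Set (Icc (0 : ℝ) T)) :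
    Measurable (S.indicator fun w : PairSpace d p T => ∫ τ in I, power E f w τ ∂(leb T)) :=
  ContinuousOn.measurable_indicator
    (continuousOn_integral_comp_curve (hE.continuous_powerFun hT hf) hS I) hSm

omit [Fact (1 ≤ p)] in
lemma abs_le_of_tendsto_Ebar {B : ℝ}
    (hB : ∀ (τ : Icc (0 : ℝ) T) (x u : Vec d), ‖x‖ ≤ M → ‖u‖ ≤ M → ‖Ebar E τ x u‖ ≤ B)
    {w : PairSpace d p T} (hw : CurveBound M w) {l : Filter (Icc (0 : ℝ) T)}
    (hl : ∀ A ∈ ae (leb T), NeBot (l ⊓ 𝓟 A)) {y : ℝ}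
    (hy : Tendsto (fun τ : Icc (0 : ℝ) T => Ebar E τ (w.1 τ) (w.2 τ)) (l ⊓ ae (leb T)) (𝓝 y)) :
    |y| ≤ B := by
  have hne : NeBot (l ⊓ ae (leb T)) := by
    rw [inf_neBot_iff]
    intro U hU A hA
    have := hl A hA
    exact inf_principal_neBot_iff.1 this U hU
  refine le_of_tendsto hy.abs (Eventually.filter_mono inf_le_right ?_)
  filter_upwards [hw.1] with τ hτ using hB τ _ _ hτ (hw.2 τ)

omit [Fact (1 ≤ p)] in
/-- The energy bounds used for integrability over the support. -/
lemma exists_bound_balance_terms (hT : 0 < T) (hE : EnergyAssumptions T E)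
    (hf : ControlAssumptions f) (hS : ∀ w ∈ S, CurveBound M w)
    (hreg : ∀ w ∈ S, IsRegulatedRep w.1 (xt w) (xm w) (xp w)) :
    ∃ B, ∀ w ∈ S, ∀ s t : Icc (0 : ℝ) T, |Ebar E t (xp w t) (w.2 t)| ≤ B ∧
      |Ebar E s (xm w s) (w.2 s)| ≤ B ∧ |∫ τ in Icc s t, power E f w τ ∂(leb T)| ≤ B := by
  obtain ⟨B₁, hB₁0, hB₁⟩ := exists_bound_of_continuous_curve hE.continuous_Ebar M
  obtain ⟨B₂, hB₂0, hB₂⟩ := exists_bound_of_continuous_curve (hE.continuous_powerFun hT hf) M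
  refine ⟨max B₁ (B₂ * (leb T).real univ), fun w hw s t => ⟨?_, ?_, ?_⟩⟩
  · exact le_max_of_le_left (abs_le_of_tendsto_Ebar hB₁ (hS w hw)
      (fun _ hA => neBot_rightSide_inf hT hA t) (IsRegulatedRep.tendsto_Ebar hE (hreg w hw).ae_eq
        (rightSide_le t) ((hreg w hw).tendsto_rightSide hT t)))
  · exact le_max_of_le_left (abs_le_of_tendsto_Ebar hB₁ (hS w hw)
      (fun _ hA => neBot_leftSide_inf hT hA s) (IsRegulatedRep.tendsto_Ebar hE (hreg w hw).ae_eq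
        (leftSide_le s) ((hreg w hw).tendsto_leftSide hT s)))
  · have hbd : ∀ᵐ τ ∂(leb T), ‖power E f w τ‖ ≤ B₂ :=
      (hS w hw).ae_norm_le (Φ := fun q => dtE T E q.1 q.2.1 - inner ℝ (f q.2.2) q.2.1) hB₂
    refine le_max_of_le_right ((norm_integral_le_of_norm_le_const
      (ae_restrict_of_ae hbd)).trans ?_)
    rw [measureReal_restrict_apply_univ]
    exact mul_le_mul_of_nonneg_left (measureReal_mono (subset_univ _)) hB₂0

/-- Dissipation measures depend measurably on the curve. -/
lemma measurable_dissipationMeasure [DecidablePred (· ∈ S)] (hE : EnergyAssumptions T E)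
    (hf : ControlAssumptions f) (hSm : MeasurableSet S) (hS : ∀ w ∈ S, CurveBound M w)
    (hreg : ∀ w ∈ S, IsRegulatedRep w.1 (xt w) (xm w) (xp w))
    (hν : ∀ w ∈ S, IsDissipationMeasure hT E f p w (ν w)) :
    Measurable fun w => if w ∈ S then ν w else 0 := by
  have hfin : ∀ w, IsFiniteMeasure (if w ∈ S then ν w else 0) := fun w => by
    split_ifs with hw
    · exact (hν w hw).1.finite
    · infer_instance
  have hIic : ∀ a : ℝ, Measurable fun w => (if w ∈ S then ν w else 0) (Iic a) := by
    intro a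
    set o : Icc (0 : ℝ) T := ⟨0, left_mem_Icc.2 hT.le⟩ with ho
    set t := projIcc 0 T hT.le a with ht
    have hot : o ≤ t := t.2.1
    -- By the balance on [0,t] this measurable function equals the mass of `Iic a` on `S`.
    have hmeas := ((measurable_indicator_Ebar_left hT hE hSm hS hreg o).add
      (measurable_indicator_power hT hE hf hSm hS (Icc o t))).sub
      (measurable_indicator_Ebar_right hT hE hSm hS hreg t)
    convert hmeas.ennreal_ofReal using 2 with w
    by_cases hw : w ∈ S
    · have := (hν w hw).1.finite
      have hbal := (hν w hw).energy_balance hE hf (hreg w hw) hot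
      simp only [Pi.add_apply, Pi.sub_apply, indicator_of_mem hw, if_pos hw]
      have hm : (ν w) (Iic a) = ENNReal.ofReal ((ν w).real (Icc (o : ℝ) t)) := by
        rw [(hν w hw).1.measure_Iic hT, ofReal_measureReal]
      rw [hm]
      congr 1
      linarith
    · simp [indicator_of_notMem hw, if_neg hw]
  refine Measurable.measure_of_isPiSystem (S := range Iic)
    ((borel_eq_generateFrom_Iic ℝ) ▸ BorelSpace.measurable_eq) isPiSystem_Iic ?_ ?_
  · rintro _ ⟨a, rfl⟩
    exact hIic a
  · convert hIic T using 2 with w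
    by_cases hw : w ∈ S
    · simp only [if_pos hw]
      have hae : ∀ᵐ τ ∂(ν w), τ ∈ Ioo 0 T := (hν w hw).1.null_compl
      refine measure_congr ?_
      filter_upwards [hae] with τ hτ
      exact propext (iff_of_true trivial hτ.2.le)
    · simp [if_neg hw]

/-- The mean-field energy balance for a law concentrated on a bounded set of limit curves. -/
theorem exists_mean_field_balance (hE : EnergyAssumptions T E)
    (hf : ControlAssumptions f) (hSm : MeasurableSet S) (hS : ∀ w ∈ S, CurveBound M w)
    (hreg : ∀ w ∈ S, IsRegulatedRep w.1 (xt w) (xm w) (xp w))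
    (hν : ∀ w ∈ S, IsDissipationMeasure hT E f p w (ν w))
    {μ : Measure (PairSpace d p T)} [IsProbabilityMeasure μ] (hμ : S ∈ ae μ) :
    ∃ 𝒱 : Measure ℝ, IsFinitePositiveOn T 𝒱 ∧
      (∀ B : Set ℝ, MeasurableSet B →
        AEMeasurable (fun w => ν w B) μ ∧ 𝒱 B = ∫⁻ w, ν w B ∂μ) ∧
      ∀ s t : Icc (0 : ℝ) T, s ≤ t →
        Integrable (fun w => Ebar E t (xp w t) (w.2 t)) μ ∧
        Integrable (fun w => Ebar E s (xm w s) (w.2 s)) μ ∧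
        Integrable (fun w => ∫ τ in Icc s t, power E f w τ ∂(leb T)) μ ∧
        (∫ w, Ebar E t (xp w t) (w.2 t) ∂μ) + 𝒱.real (Icc s t) =
          ∫ w, (Ebar E s (xm w s) (w.2 s) + ∫ τ in Icc s t, power E f w τ ∂(leb T)) ∂μ := by
  classical
  obtain ⟨C, hC⟩ := exists_bound_balance_terms hT hE hf hS hreg
  have hνm := measurable_dissipationMeasure hE hf hSm hS hreg hν
  have hae : ∀ B : Set ℝ, (fun w => (if w ∈ S then ν w else 0) B) =ᵐ[μ] fun w => ν w B := by
    intro B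
    filter_upwards [hμ] with w hw
    rw [if_pos hw]
  have hBm : ∀ B : Set ℝ, MeasurableSet B →
      Measurable fun w => (if w ∈ S then ν w else 0) B :=
    fun B hB => (Measure.measurable_coe hB).comp hνm
  -- Off `S` the choice ν is arbitrary, so it is replaced by 0 there; almost every curve is
  -- unaffected.
  set 𝒱 := μ.bind fun w => if w ∈ S then ν w else 0 with h𝒱
  have happly : ∀ B : Set ℝ, MeasurableSet B → 𝒱 B = ∫⁻ w, ν w B ∂μ := by
    intro B hB
    rw [h𝒱, Measure.bind_apply hB hνm.aemeasurable, lintegral_congr_ae (hae B)]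
  have hnull : 𝒱 (Ioo 0 T)ᶜ = 0 := by
    rw [happly _ measurableSet_Ioo.compl, lintegral_congr_ae (g := fun _ => 0), lintegral_zero]
    filter_upwards [hμ] with w hw using (hν w hw).1.null_compl
  have hIcc : ∀ s t : Icc (0 : ℝ) T, s ≤ t → ∀ w ∈ S, (ν w).real (Icc s t) =
      Ebar E s (xm w s) (w.2 s) + (∫ τ in Icc s t, power E f w τ ∂(leb T))
        - Ebar E t (xp w t) (w.2 t) := fun s t hst w hw => by
    have := (hν w hw).energy_balance hE hf (hreg w hw) hst
    linarith
  have hint : ∀ s t : Icc (0 : ℝ) T, s ≤ t →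
      Integrable (fun w => Ebar E t (xp w t) (w.2 t)) μ ∧
      Integrable (fun w => Ebar E s (xm w s) (w.2 s)) μ ∧
      Integrable (fun w => ∫ τ in Icc s t, power E f w τ ∂(leb T)) μ := fun s t _ =>
    ⟨integrable_of_measurable_indicator hμ
      (measurable_indicator_Ebar_right hT hE hSm hS hreg t) fun w hw => (hC w hw s t).1,
    integrable_of_measurable_indicator hμ
      (measurable_indicator_Ebar_left hT hE hSm hS hreg s) fun w hw => (hC w hw s t).2.1,
    integrable_of_measurable_indicator hμ
      (measurable_indicator_power hT hE hf hSm hS (Icc s t)) fun w hw => (hC w hw s t).2.2⟩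
  have happlyIcc : ∀ s t : Icc (0 : ℝ) T, s ≤ t →
      𝒱 (Icc s t) = ENNReal.ofReal (∫ w, (Ebar E s (xm w s) (w.2 s)
        + (∫ τ in Icc s t, power E f w τ ∂(leb T)) - Ebar E t (xp w t) (w.2 t)) ∂μ) ∧
      0 ≤ ∫ w, (Ebar E s (xm w s) (w.2 s)
        + (∫ τ in Icc s t, power E f w τ ∂(leb T)) - Ebar E t (xp w t) (w.2 t)) ∂μ := by
    intro s t hst
    obtain ⟨h1, h2, h3⟩ := hint s t hst
    have hnn : 0 ≤ᵐ[μ] fun w => Ebar E s (xm w s) (w.2 s)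
        + (∫ τ in Icc s t, power E f w τ ∂(leb T)) - Ebar E t (xp w t) (w.2 t) := by
      filter_upwards [hμ] with w hw
      rw [← hIcc s t hst w hw]
      exact measureReal_nonneg
    refine ⟨?_, integral_nonneg_of_ae hnn⟩
    have hi : Integrable (fun w => Ebar E s (xm w s) (w.2 s)
        + (∫ τ in Icc s t, power E f w τ ∂(leb T)) - Ebar E t (xp w t) (w.2 t)) μ :=
      (h2.add h3).sub h1
    rw [happly _ measurableSet_Icc, ofReal_integral_eq_lintegral_ofReal hi hnn]
    refine lintegral_congr_ae ?_
    filter_upwards [hμ] with w hw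
    have := (hν w hw).1.finite
    rw [← hIcc s t hst w hw, ofReal_measureReal]
  -- The balance on [0,T] gives the total mass as a real integral of bounded terms.
  have hfin : IsFiniteMeasure 𝒱 := by
    constructor
    have hot : (⟨0, left_mem_Icc.2 hT.le⟩ : Icc (0 : ℝ) T) ≤ ⟨T, right_mem_Icc.2 hT.le⟩ := hT.le
    have huniv : 𝒱 univ = 𝒱 (Icc 0 T) := by
      refine measure_congr ?_
      have hae : ∀ᵐ τ ∂𝒱, τ ∈ Ioo 0 T := hnull
      filter_upwards [hae] with τ hτ
      exact propext (iff_of_true trivial (Ioo_subset_Icc_self hτ))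
    rw [huniv, (happlyIcc _ _ hot).1]
    exact ENNReal.ofReal_lt_top
  refine ⟨𝒱, ⟨hfin, hnull⟩, fun B hB => ⟨(hBm B hB).aemeasurable.congr (hae B), happly B hB⟩,
    fun s t hst => ?_⟩
  obtain ⟨h1, h2, h3⟩ := hint s t hst
  refine ⟨h1, h2, h3, ?_⟩
  have h23 : Integrable (fun w => Ebar E s (xm w s) (w.2 s)
      + ∫ τ in Icc s t, power E f w τ ∂(leb T)) μ := h2.add h3
  rw [measureReal_def, (happlyIcc s t hst).1, ENNReal.toReal_ofReal (happlyIcc s t hst).2,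
    integral_sub h23 h1]
  ring

end MeanField

theorem theorem3p7 {d : ℕ} {T : ℝ} (hT : 0 < T)
    (E : ℝ → Vec d → ℝ) (hE : EnergyAssumptions T E)
    (f : Vec d → Vec d) (hf : ControlAssumptions f)
    (p : ℝ≥0∞) [Fact (1 ≤ p)] (hp : p ≠ ⊤)
    (η₀ : Measure (Vec d × Vec d)) [IsProbabilityMeasure η₀]
    (hη₀ : ∃ K : Set (Vec d × Vec d), IsCompact K ∧ η₀ Kᶜ = 0)
    (P : Measure (PathSpace d p T)) [IsProbabilityMeasure P]
    (hP : IsNarrowLimitPoint hT E f p η₀ P) :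
    -- every curve in the support of `Π*` has a regulated representative and exactly one
    -- dissipation measure
    (pairMarginal P) (pairMarginal P).supportᶜ = 0 ∧
    (∀ w ∈ (pairMarginal P).support,
      (∃ xt xm xp : Icc (0 : ℝ) T → Vec d, IsRegulatedRep w.1 xt xm xp) ∧
      (∃! ν : Measure ℝ, IsDissipationMeasure hT E f p w ν) ∧
      Integrable (power E f w) (leb T)) ∧
    -- for every choice of these, the mean-field energy balance holds
    ∀ (xt xm xp : PairSpace d p T → Icc (0 : ℝ) T → Vec d) (ν : PairSpace d p T → Measure ℝ),
      (∀ w ∈ (pairMarginal P).support, IsRegulatedRep w.1 (xt w) (xm w) (xp w)) →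
      (∀ w ∈ (pairMarginal P).support, IsDissipationMeasure hT E f p w (ν w)) →
      ∃ 𝒱 : Measure ℝ, IsFinitePositiveOn T 𝒱 ∧
        (∀ B : Set ℝ, MeasurableSet B →
          AEMeasurable (fun ω : PathSpace d p T => ν ω.2.2 B) P ∧
          𝒱 B = ∫⁻ ω, ν ω.2.2 B ∂P) ∧
        ∀ s t : Icc (0 : ℝ) T, s ≤ t →
          Integrable (fun w => Ebar E t (xp w t) (w.2 t)) (pairMarginal P) ∧
          Integrable (fun w => Ebar E s (xm w s) (w.2 s)) (pairMarginal P) ∧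
          Integrable (fun w => ∫ τ in Icc s t, power E f w τ ∂(leb T)) (pairMarginal P) ∧
          (∫ w, Ebar E t (xp w t) (w.2 t) ∂(pairMarginal P)) + 𝒱.real (Icc s t) =
            ∫ w, (Ebar E s (xm w s) (w.2 s) + ∫ τ in Icc s t, power E f w τ ∂(leb T))
              ∂(pairMarginal P) := by
  obtain ⟨K, hKc, hK⟩ := hη₀
  -- Finite p makes Γ_T^p separable, which is why the support carries the full mass of Π*.
  have : Fact (p ≠ ⊤) := ⟨hp⟩
  have hprob : IsProbabilityMeasure (pairMarginal P) := isProbabilityMeasure_pairMarginal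
  have hSae : (pairMarginal P).support ∈ ae (pairMarginal P) := Measure.support_mem_ae
  obtain ⟨M, hM⟩ := exists_curveBound_support hE hf hKc hK hP
  have hproj : Measurable fun ω : PathSpace d p T => ω.2.2 := measurable_snd.snd
  refine ⟨Measure.measure_compl_support, fun w hw => ?_, fun xt xm xp ν hreg hν => ?_⟩
  · obtain ⟨ν, hν⟩ := exists_isDissipationMeasure_of_mem_support hE hf hKc hK hP hw
    exact ⟨hν.exists_isRegulatedRep hE hf, ⟨ν, hν, fun ν' hν' => hν'.unique hE hf hν⟩,
      (hM w hw).integrable (hE.continuous_powerFun hT hf)⟩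
  · obtain ⟨𝒱, h𝒱, hB, hbal⟩ := exists_mean_field_balance hE hf
      Measure.isClosed_support.measurableSet hM hreg hν hSae
    refine ⟨𝒱, h𝒱, fun B hBm => ⟨(hB B hBm).1.comp_measurable hproj, ?_⟩, hbal⟩
    rw [(hB B hBm).2, pairMarginal, lintegral_map' (hB B hBm).1 hproj.aemeasurable]
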